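/- Let $H$ be a Lie group, $\pi:\mathcal P\to\mathcal M$ a smooth principal $H$-bundle (finite-dimensional Hausdorff manifolds), $\mathcal A$ the space of smooth Ehresmann connections on $\mathcal P$ — an affine space modelled on $\Omega^1_{\rm tens}(\mathcal P,\mathrm{Lie}H)$, so that $T_A\mathcal A=\Omega^1_{\rm tens}(\mathcal P,\mathrm{Lie}H)$ — and $\mathcal H=\{\gamma:\mathcal P\to H \text{ smooth}\mid \gamma(ph)=h^{-1}\gamma(p)h\}$ the gauge group, with Lie algebra $\mathrm{Lie}\mathcal H=\{\chi:\mathcal P\to\mathrm{Lie}H\text{ smooth}\mid\chi(ph)=h^{-1}\chi(p)h\}$ (for $h\in H$ and $X\in\mathrm{Lie}H$, $h^{-1}Xh$ denotes $\mathrm{Ad}_{h^{-1}}X$). The group $\mathcal H$ acts on $\mathcal A$ from the right by $R_\gamma A=A^\gamma:=f_\gamma^*A$, $f_\gamma(p)=p\,\gamma(p)$. For $\chi\in\mathrm{Lie}\mathcal H$ let $\chi^v_A\in T_A\mathcal A$ be the fundamental vertical vector $\frac{d}{d\tau}A^{g_\tau}|_{\tau=0}$, where $g_\tau$ is any smooth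 curve in $\mathcal H$ with $g_0=1$ and $\dot g_0=\chi$ (e.g. $g_\tau=\exp(\tau\chi)$). Put $D^A\chi=d\chi+[A,\chi]$ and $F(A)=dA+\tfrac12[A,A]$. A family in $\mathcal A$ or in $\mathcal H$ with parameters in $\mathbb R^n$ is smooth if it is jointly smooth in the parameter and the argument; a map between these spaces is smooth if it sends smooth families to smooth families; differentials (pushforwards, and the variational derivative $\boldsymbol d$ of functionals on $\mathcal A$) are taken along arbitrary smooth curves through the given point with the given velocity. Let $\boldsymbol\gamma:\mathcal A\to\mathcal H$ be smooth with $\boldsymbol\gamma(A^{g})=g^{-1}\boldsymbol\gamma(A)g$ for all $g\in\mathcal H$, and let $\boldsymbol\Psi(A)=A^{\boldsymbol\gamma(A)}$ be the corresponding vertical automorphism of $\mathcal A$. Then for every $A\in\mathcal A$ and every $\boldsymbol X_A\in T_A\mathcal A$, all the derivatives below exist, depend only on $\boldsymbol X_A$ and not on the curve, $\boldsymbol\gamma^{-1}\boldsymbol d\boldsymbol\gamma_{|A}(\boldsymbol X_A)$ and $\boldsymbol d\boldsymbol\gamma\boldsymbol\gamma^{-1}{}_{|A}(\boldsymbol X_A)$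 lie in $\mathrm{Lie}\mathcal H$, and $$\boldsymbol\Psi_\star\boldsymbol X_A=R_{\boldsymbol\gamma(A)\star}\boldsymbol X_A+\{\boldsymbol\gamma^{-1}\boldsymbol d\boldsymbol\gamma_{|A}(\boldsymbol X_A)\}^v_{A^{\boldsymbol\gamma(A)}}=R_{\boldsymbol\gamma(A)\star}\big(\boldsymbol X_A+\{\boldsymbol d\boldsymbol\gamma\boldsymbol\gamma^{-1}{}_{|A}(\boldsymbol X_A)\}^v_A\big).$$ Moreover, with $\boldsymbol dA^{\boldsymbol\gamma}:=\boldsymbol\Psi^\star\boldsymbol dA$ and $\boldsymbol dF^{\boldsymbol\gamma}:=\boldsymbol\Psi^\star\boldsymbol dF$, that is $\boldsymbol dA^{\boldsymbol\gamma}_{|A}(\boldsymbol X_A)=\boldsymbol dA_{|\boldsymbol\Psi(A)}(\boldsymbol\Psi_\star\boldsymbol X_A)$ and likewise for $F$, $$\boldsymbol dA^{\boldsymbol\gamma}_{|A}(\boldsymbol X_A)=\boldsymbol\gamma(A)^{-1}\Big(\boldsymbol dA_{|A}(\boldsymbol X_A)+D^A\{\boldsymbol d\boldsymbol\gamma\boldsymbol\gamma^{-1}{}_{|A}(\boldsymbol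 X_A)\}\Big)\boldsymbol\gamma(A),$$ $$\boldsymbol dF^{\boldsymbol\gamma}_{|A}(\boldsymbol X_A)=\boldsymbol\gamma(A)^{-1}\Big(\boldsymbol dF_{|A}(\boldsymbol X_A)+\big[F(A),\boldsymbol d\boldsymbol\gamma\boldsymbol\gamma^{-1}{}_{|A}(\boldsymbol X_A)\big]\Big)\boldsymbol\gamma(A).$$ -/

import Mathlib

open scoped Manifold ContDiff Topology

noncomputable section

namespace GaugeBundle

/-- A smooth principal bundle `proj : P → M` with structure group the Lie group `H`, acting
on `P` from the right by `act`. -/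
structure PrincipalBundle
    (EM EP EH : Type*) [NormedAddCommGroup EM] [NormedSpace ℝ EM]
    [NormedAddCommGroup EP] [NormedSpace ℝ EP] [NormedAddCommGroup EH] [NormedSpace ℝ EH]
    (M P H : Type*) [TopologicalSpace M] [ChartedSpace EM M] [TopologicalSpace P]
    [ChartedSpace EP P] [TopologicalSpace H] [ChartedSpace EH H] [Group H] where
  proj : P → M
  act : P → H → P
  act_one : ∀ p, act p 1 = p
  act_mul : ∀ p h k, act p (h * k) = act (act p h) k
  proj_act : ∀ p h, proj (act p h) = proj p
  contMDiff_proj : ContMDiff 𝓘(ℝ, EP) 𝓘(ℝ, EM) ∞ proj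
  contMDiff_act : ContMDiff (𝓘(ℝ, EP).prod 𝓘(ℝ, EH)) 𝓘(ℝ, EP) ∞
    (fun q : P × H => act q.1 q.2)
  locally_trivial : ∀ x : M, ∃ U : Set M, IsOpen U ∧ x ∈ U ∧
    ∃ e : OpenPartialHomeomorph P (M × H),
      e.source = proj ⁻¹' U ∧ e.target = U ×ˢ Set.univ ∧
      ContMDiffOn 𝓘(ℝ, EP) (𝓘(ℝ, EM).prod 𝓘(ℝ, EH)) ∞ e e.source ∧
      ContMDiffOn (𝓘(ℝ, EM).prod 𝓘(ℝ, EH)) 𝓘(ℝ, EP) ∞ e.symm e.target ∧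
      (∀ p ∈ e.source, (e p).1 = proj p) ∧
      (∀ p ∈ e.source, ∀ h, (e (act p h)).2 = (e p).2 * h)

section LieAlgebra

variable {EH : Type*} [NormedAddCommGroup EH] [NormedSpace ℝ EH]
  {H : Type*} [TopologicalSpace H] [ChartedSpace EH H] [Group H]

/- The Lie algebra `Lie H` is the tangent space of `H` at `1`. It is a type synonym of the model
space `EH`, and we write its elements as elements of `EH`. The same holds for velocities
at points of `H` that are equal to `1`, but not syntactically so. -/

variable (H) in
/-- The bracket of `Lie H`. -/
def bracket (X Y : EH) : EH :=
  let X' : GroupLieAlgebra 𝓘(ℝ, EH) H := X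
  let Y' : GroupLieAlgebra 𝓘(ℝ, EH) H := Y
  (⁅X', Y'⁆ : GroupLieAlgebra 𝓘(ℝ, EH) H)

/-- The adjoint action `X ↦ h X h⁻¹` of `H` on `Lie H`: the derivative at `1` of the
conjugation `k ↦ h k h⁻¹`. -/
def Ad (h : H) : EH →L[ℝ] EH :=
  (mfderiv 𝓘(ℝ, EH) 𝓘(ℝ, EH) (fun k : H => h * k * h⁻¹) 1 :)

end LieAlgebra

variable {EM EP EH : Type*} [NormedAddCommGroup EM] [NormedSpace ℝ EM]
  [NormedAddCommGroup EP] [NormedSpace ℝ EP] [NormedAddCommGroup EH] [NormedSpace ℝ EH]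
  {M P H : Type*} [TopologicalSpace M] [ChartedSpace EM M] [TopologicalSpace P]
  [ChartedSpace EP P] [TopologicalSpace H] [ChartedSpace EH H] [Group H]

namespace PrincipalBundle

/-- The vertical vector `X^v_p`, the derivative at `1` of `h ↦ p h` applied to `X ∈ Lie H`. -/
def vert (B : PrincipalBundle EM EP EH M P H) (X : EH) (p : P) : TangentBundle 𝓘(ℝ, EP) P :=
  tangentMap 𝓘(ℝ, EH) 𝓘(ℝ, EP) (B.act p) ⟨1, X⟩

/-- The pushforward of tangent vectors of `P` by the right translation by `h`. -/
def rightPush (B : PrincipalBundle EM EP EH M P H) (h : H) :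
    TangentBundle 𝓘(ℝ, EP) P → TangentBundle 𝓘(ℝ, EP) P :=
  tangentMap 𝓘(ℝ, EP) 𝓘(ℝ, EP) (fun p => B.act p h)

end PrincipalBundle

section Forms

set_option linter.unusedSectionVars false

variable [IsManifold 𝓘(ℝ, EP) ∞ P]

/-- A smooth `Lie H`-valued 1-form on `P`: a smooth function on `TP`, linear on each fibre. -/
structure IsOneForm (α : TangentBundle 𝓘(ℝ, EP) P → EH) : Prop where
  smooth : ContMDiff 𝓘(ℝ, EP).tangent 𝓘(ℝ, EH) ∞ α
  map_add : ∀ (p : P) (u v : TangentSpace 𝓘(ℝ, EP) p), α ⟨p, u + v⟩ = α ⟨p, u⟩ + α ⟨p, v⟩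
  map_smul : ∀ (p : P) (a : ℝ) (v : TangentSpace 𝓘(ℝ, EP) p), α ⟨p, a • v⟩ = a • α ⟨p, v⟩

variable (B : PrincipalBundle EM EP EH M P H)

/-- Ehresmann connections on `P`. -/
structure Connection where
  toFun : TangentBundle 𝓘(ℝ, EP) P → EH
  isOneForm : IsOneForm toFun
  equivariant : ∀ (h : H) (v : TangentBundle 𝓘(ℝ, EP) P),
    toFun (B.rightPush h v) = Ad h⁻¹ (toFun v)
  map_vert : ∀ (X : EH) (p : P), toFun (B.vert X p) = X

/-- `Ω¹_tens(P, Lie H)`, which is the tangent space of the affine space of connections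
at each of its points. -/
structure Tensorial where
  toFun : TangentBundle 𝓘(ℝ, EP) P → EH
  isOneForm : IsOneForm toFun
  equivariant : ∀ (h : H) (v : TangentBundle 𝓘(ℝ, EP) P),
    toFun (B.rightPush h v) = Ad h⁻¹ (toFun v)
  map_vert : ∀ (X : EH) (p : P), toFun (B.vert X p) = 0

/-- The gauge group: smooth maps `g : P → H` with `g (p h) = h⁻¹ g(p) h`. -/
@[ext]
structure Gauge where
  toFun : P → H
  smooth : ContMDiff 𝓘(ℝ, EP) 𝓘(ℝ, EH) ∞ toFun
  equivariant : ∀ p h, toFun (B.act p h) = h⁻¹ * toFun p * h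

/-- The Lie algebra of the gauge group: smooth maps `χ : P → Lie H` with
`χ (p h) = h⁻¹ χ(p) h`. -/
structure LieGauge where
  toFun : P → EH
  smooth : ContMDiff 𝓘(ℝ, EP) 𝓘(ℝ, EH) ∞ toFun
  equivariant : ∀ p h, toFun (B.act p h) = Ad h⁻¹ (toFun p)

variable {B}

instance : CoeFun (Connection B) (fun _ => TangentBundle 𝓘(ℝ, EP) P → EH) := ⟨Connection.toFun⟩
instance : CoeFun (Tensorial B) (fun _ => TangentBundle 𝓘(ℝ, EP) P → EH) := ⟨Tensorial.toFun⟩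
instance : CoeFun (Gauge B) (fun _ => P → H) := ⟨Gauge.toFun⟩
instance : CoeFun (LieGauge B) (fun _ => P → EH) := ⟨LieGauge.toFun⟩

instance : Add (Tensorial B) where
  add V W :=
    { toFun := fun v => V v + W v
      isOneForm :=
        { smooth := V.isOneForm.smooth.add W.isOneForm.smooth
          map_add := fun p u v => by
            rw [V.isOneForm.map_add, W.isOneForm.map_add]; abel
          map_smul := fun p a v => by
            rw [V.isOneForm.map_smul, W.isOneForm.map_smul, smul_add] }
      equivariant := fun h v => by
        rw [V.equivariant, W.equivariant, map_add]
      map_vert := fun X p => by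
        rw [V.map_vert, W.map_vert, add_zero] }

section GaugeGroup

variable [LieGroup 𝓘(ℝ, EH) ∞ H]

instance : Mul (Gauge B) where
  mul g k :=
    { toFun := fun p => g p * k p
      smooth := g.smooth.mul k.smooth
      equivariant := fun p h => by rw [g.equivariant, k.equivariant]; group }

instance : One (Gauge B) where
  one :=
    { toFun := fun _ => 1
      smooth := contMDiff_const
      equivariant := fun p h => by group }

instance : Inv (Gauge B) where
  inv g :=
    { toFun := fun p => (g p)⁻¹
      smooth := g.smooth.inv
      equivariant := fun p h => by rw [g.equivariant]; group }

/-- The gauge group is a group under pointwise multiplication. -/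
instance : Group (Gauge B) :=
  Group.ofLeftAxioms
    (fun a b c => Gauge.ext (funext fun p => mul_assoc (a p) (b p) (c p)))
    (fun a => Gauge.ext (funext fun p => one_mul (a p)))
    (fun a => Gauge.ext (funext fun p => inv_mul_cancel (a p)))

end GaugeGroup

/-- The vertical automorphism `p ↦ p g(p)` of `P` defined by a gauge group element. -/
def Gauge.map (g : Gauge B) (p : P) : P := B.act p (g p)

theorem Gauge.contMDiff_map (g : Gauge B) : ContMDiff 𝓘(ℝ, EP) 𝓘(ℝ, EP) ∞ g.map :=
  B.contMDiff_act.comp (contMDiff_id.prodMk g.smooth)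

theorem Gauge.map_act (g : Gauge B) (p : P) (h : H) : g.map (B.act p h) = B.act (g.map p) h := by
  simp only [Gauge.map, g.equivariant, ← B.act_mul]
  congr 1
  group

theorem PrincipalBundle.contMDiff_act_right (B : PrincipalBundle EM EP EH M P H) (h : H) :
    ContMDiff 𝓘(ℝ, EP) 𝓘(ℝ, EP) ∞ (fun p => B.act p h) :=
  B.contMDiff_act.comp (contMDiff_id.prodMk contMDiff_const)

theorem PrincipalBundle.contMDiff_act_left (B : PrincipalBundle EM EP EH M P H) (p : P) :
    ContMDiff 𝓘(ℝ, EH) 𝓘(ℝ, EP) ∞ (B.act p) :=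
  B.contMDiff_act.comp (contMDiff_const.prodMk contMDiff_id)

theorem Gauge.tangentMap_rightPush (g : Gauge B) (h : H) (v : TangentBundle 𝓘(ℝ, EP) P) :
    tangentMap 𝓘(ℝ, EP) 𝓘(ℝ, EP) g.map (B.rightPush h v) =
      B.rightPush h (tangentMap 𝓘(ℝ, EP) 𝓘(ℝ, EP) g.map v) := by
  unfold PrincipalBundle.rightPush
  have hg := g.contMDiff_map.mdifferentiable (by simp)
  have hh := (B.contMDiff_act_right h).mdifferentiable (by simp)
  rw [← tangentMap_comp_at v (hg _) (hh _), ← tangentMap_comp_at v (hh _) (hg _)]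
  congr 1
  exact funext fun p => g.map_act p h

theorem Gauge.tangentMap_vert (g : Gauge B) (X : EH) (p : P) :
    tangentMap 𝓘(ℝ, EP) 𝓘(ℝ, EP) g.map (B.vert X p) = B.vert X (g.map p) := by
  unfold PrincipalBundle.vert
  have hg := g.contMDiff_map.mdifferentiable (by simp)
  have hp := (B.contMDiff_act_left p).mdifferentiable (by simp)
  rw [← tangentMap_comp_at _ (hg _) (hp _)]
  congr 1
  exact funext fun h => g.map_act p h

/-- The right action `A ↦ A^g` of the gauge group on connections: the pullback of `A` by the
vertical automorphism `p ↦ p g(p)`. -/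
def Connection.gauge (A : Connection B) (g : Gauge B) : Connection B where
  toFun := fun v => A (tangentMap 𝓘(ℝ, EP) 𝓘(ℝ, EP) g.map v)
  isOneForm :=
    { smooth := A.isOneForm.smooth.comp (g.contMDiff_map.contMDiff_tangentMap (by simp))
      map_add := fun p u v => by
        have := A.isOneForm.map_add (g.map p)
          (mfderiv 𝓘(ℝ, EP) 𝓘(ℝ, EP) g.map p u) (mfderiv 𝓘(ℝ, EP) 𝓘(ℝ, EP) g.map p v)
        rw [← ContinuousLinearMap.map_add] at this
        exact this
      map_smul := fun p a v => by
        have := A.isOneForm.map_smul (g.map p) a (mfderiv 𝓘(ℝ, EP) 𝓘(ℝ, EP) g.map p v)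
        rw [← ContinuousLinearMap.map_smul] at this
        exact this }
  equivariant := fun h v => by rw [g.tangentMap_rightPush, A.equivariant]
  map_vert := fun X p => by rw [g.tangentMap_vert, A.map_vert]

/-- The covariant derivative `D^A χ = dχ + [A, χ]`. -/
def covDeriv (A : Connection B) (χ : LieGauge B) (v : TangentBundle 𝓘(ℝ, EP) P) : EH :=
  let dχ : EH := mfderiv 𝓘(ℝ, EP) 𝓘(ℝ, EH) χ v.1 v.2
  dχ + bracket H (A v) (χ v.1)

/-- The local representative, in the preferred chart at `p`, of a 1-form `α` on `P`. -/
def localForm (α : TangentBundle 𝓘(ℝ, EP) P → EH) (p : P) (x w : EP) : EH :=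
  α (tangentMap 𝓘(ℝ, EP) 𝓘(ℝ, EP) (extChartAt 𝓘(ℝ, EP) p).symm ⟨x, w⟩)

/-- The exterior derivative of a 1-form on `P`, computed at `p` in the preferred chart at `p`
(the tangent space at `p` is identified with `EP` through that chart). -/
def extDerivOneForm (α : TangentBundle 𝓘(ℝ, EP) P → EH) (p : P)
    (u v : TangentSpace 𝓘(ℝ, EP) p) : EH :=
  fderiv ℝ (fun x => localForm α p x v) (extChartAt 𝓘(ℝ, EP) p p) u -
    fderiv ℝ (fun x => localForm α p x u) (extChartAt 𝓘(ℝ, EP) p p) v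

/-- A point of `P` together with two tangent vectors at this point. -/
abbrev TangentPair (EP P : Type*) [NormedAddCommGroup EP] [NormedSpace ℝ EP]
    [TopologicalSpace P] [ChartedSpace EP P] :=
  Σ p : P, TangentSpace 𝓘(ℝ, EP) p × TangentSpace 𝓘(ℝ, EP) p

/-- The curvature `F(A) = dA + ½[A, A]`; here `½[A, A](u, v) = [A u, A v]`. -/
def curvature (A : Connection B) (q : TangentPair EP P) : EH :=
  extDerivOneForm A q.1 q.2.1 q.2.2 + bracket H (A ⟨q.1, q.2.1⟩) (A ⟨q.1, q.2.2⟩)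

section Variational

/- The calculus on the space of connections and on the gauge group. A family of connections, or of
gauge group elements, is smooth if it is jointly smooth in the parameter and in the argument.
A map between these spaces is smooth if it sends smooth families to smooth families, and its
differential at a point, on a tangent vector `X`, is the velocity of the image of any smooth curve
through this point with velocity `X` (for instance, of an orbit of the flow of a vector field). -/

variable {F : Type*} [NormedAddCommGroup F] [NormedSpace ℝ F]

/-- Smooth families of connections with parameters in `F`. -/
def SmoothFamily (c : F → Connection B) : Prop :=
  ContMDiff (𝓘(ℝ, F).prod 𝓘(ℝ, EP).tangent) 𝓘(ℝ, EH) ∞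
    (fun q : F × TangentBundle 𝓘(ℝ, EP) P => c q.1 q.2)

/-- Smooth families of gauge group elements with parameters in `F`. -/
def SmoothGaugeFamily (g : F → Gauge B) : Prop :=
  ContMDiff (𝓘(ℝ, F).prod 𝓘(ℝ, EP)) 𝓘(ℝ, EH) ∞ (fun q : F × P => g q.1 q.2)

/-- `c` is a smooth curve of connections with `c 0 = A` and velocity `X` at `0`. -/
def IsCurveAt (c : ℝ → Connection B) (A : Connection B) (X : Tensorial B) : Prop :=
  SmoothFamily c ∧ c 0 = A ∧ ∀ v, HasDerivAt (fun τ => c τ v) (X v) 0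

/-- `g` is a smooth curve in the gauge group with `g 0 = 1` and velocity `χ` at `0`. -/
def IsGaugeCurve [LieGroup 𝓘(ℝ, EH) ∞ H] (g : ℝ → Gauge B) (χ : LieGauge B) : Prop :=
  SmoothGaugeFamily g ∧ g 0 = 1 ∧
    ∀ p, MDifferentiableAt 𝓘(ℝ, ℝ) 𝓘(ℝ, EH) (fun τ => g τ p) 0 ∧
      (mfderiv 𝓘(ℝ, ℝ) 𝓘(ℝ, EH) (fun τ => g τ p) 0 (1 : ℝ) : EH) = χ p

/-- The pushforward `Φ_⋆ X` of the tangent vector `X` at `A` is the tangent vector `Y`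
at `Φ A`. -/
def IsPushforward (Φ : Connection B → Connection B) (A : Connection B) (X Y : Tensorial B) :
    Prop :=
  ∀ c : ℝ → Connection B, IsCurveAt c A X → IsCurveAt (fun τ => Φ (c τ)) (Φ A) Y

/-- `Z` is the value `dK_A(X)` at `A`, on the tangent vector `X`, of the variational exterior
derivative of the functional `K` with values in `Lie H`-valued functions on `ι`. -/
def IsVariation {ι : Type*} (K : Connection B → ι → EH) (A : Connection B) (X : Tensorial B)
    (Z : ι → EH) : Prop :=
  ∀ c : ℝ → Connection B, IsCurveAt c A X → ∀ i, HasDerivAt (fun τ => K (c τ) i) (Z i) 0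

/-- `V` is the fundamental vertical vector `χ^v_A` of the action of the gauge group: the velocity
of `A^{g(τ)}` at `τ = 0`, for any smooth curve `g` in the gauge group through `1` with velocity `χ`
(for instance `g(τ) = exp(τ χ)`). -/
def IsFundamental [LieGroup 𝓘(ℝ, EH) ∞ H] (A : Connection B) (χ : LieGauge B) (V : Tensorial B) :
    Prop :=
  (∃ g : ℝ → Gauge B, IsGaugeCurve g χ) ∧
    ∀ g : ℝ → Gauge B, IsGaugeCurve g χ → IsCurveAt (fun τ => A.gauge (g τ)) A V

/-- A vertical automorphism of the space of connections, as a bundle for the gauge group. -/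
structure IsVerticalAutomorphism (Ψ : Connection B → Connection B) : Prop where
  smooth : ∀ (n : ℕ) (c : EuclideanSpace ℝ (Fin n) → Connection B),
    SmoothFamily c → SmoothFamily (fun s => Ψ (c s))
  equivariant : ∀ A g, Ψ (A.gauge g) = (Ψ A).gauge g
  vertical : ∀ A, ∃ g, Ψ A = A.gauge g

variable (B) in
/-- The gauge group of the space of connections, i.e. the field-dependent gauge
transformations: smooth maps `γ` from connections to the gauge group such
that `γ(A^g) = g⁻¹ γ(A) g`. -/
structure FieldGauge [LieGroup 𝓘(ℝ, EH) ∞ H] where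
  toFun : Connection B → Gauge B
  smooth : ∀ (n : ℕ) (c : EuclideanSpace ℝ (Fin n) → Connection B),
    SmoothFamily c → SmoothGaugeFamily (fun s => toFun (c s))
  equivariant : ∀ A g, toFun (A.gauge g) = g⁻¹ * toFun A * g

instance [LieGroup 𝓘(ℝ, EH) ∞ H] : CoeFun (FieldGauge B) (fun _ => Connection B → Gauge B) :=
  ⟨FieldGauge.toFun⟩

/-- `ξ` is the element `dγ γ⁻¹|_A (X)` of the Lie algebra of the gauge group. -/
def IsRightLogDeriv [LieGroup 𝓘(ℝ, EH) ∞ H] (γ : Connection B → Gauge B) (A : Connection B)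
    (X : Tensorial B) (ξ : LieGauge B) : Prop :=
  ∀ c : ℝ → Connection B, IsCurveAt c A X → IsGaugeCurve (fun τ => γ (c τ) * (γ A)⁻¹) ξ

/-- `ζ` is the element `γ⁻¹ dγ|_A (X)` of the Lie algebra of the gauge group. -/
def IsLeftLogDeriv [LieGroup 𝓘(ℝ, EH) ∞ H] (γ : Connection B → Gauge B) (A : Connection B)
    (X : Tensorial B) (ζ : LieGauge B) : Prop :=
  ∀ c : ℝ → Connection B, IsCurveAt c A X → IsGaugeCurve (fun τ => (γ A)⁻¹ * γ (c τ)) ζ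

end Variational

end Forms

end GaugeBundle

end

/-! Everything reduces to the pointwise formula `A^g = Ad(g⁻¹) A + g⁻¹dg`, the identity `A^(gk) =
(A^g)^k`, and ordinary calculus in finitely many variables. If `c` is a curve through `A` with
velocity `X`, then `Ψ(c τ) = c(τ)^γ(c τ)` equals `(c(τ)^k(τ))^γ(A)` with `k(τ) = γ(c τ) γ(A)⁻¹`, a
curve of gauge transformations starting at `1`. The inner curve has velocity `X + D^A ξ`, where `ξ`
is the velocity of `k`, and the outer action by the fixed element `γ(A)` only precomposes with a
tangent map, so it passes through the derivative unchanged. This gives the pushforward with `ξ`;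
moving `γ(A)` to the other side turns `ξ` into `ζ`. The formula for `dA` is then the evaluation of
tensorial forms on vectors pushed by `p ↦ p g(p)`.

Three points carry the weight. First, the fundamental vector is `χ^v_A = D^A χ`
(`IsGaugeCurve.hasDerivAt_gauge`). This needs the derivative of `Ad` at `1` to be the bracket
defined by left-invariant fields (`fderiv_Ad_chart`), and the derivative of `g⁻¹dg` along a curve
through `1` to be `dχ` (`hasDerivAt_maurerCartan`).

Second, `ξ` must depend on `X` alone (`FieldGauge.mder_curve_eq`). Since `γ` is only known to
preserve smooth families, no chain rule on the space of connections is available. Hadamard's lemma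
writes `c(t) = A + t q(t)` with `q` smooth and `q(0) = X`. The two-parameter family `A + s q(t)`
contains `c` as its diagonal, the affine line `A + sX` as the slice `t = 0`, and the constant `A` as
the slice `s = 0`; the chain rule on the plane then compares the first two.

Third, the variation of the curvature is `D^A X` (`IsCurveAt.hasDerivAt_curvature`), and `D` is
gauge covariant (`covExtDeriv_gauge`), so the variation at `Ψ(A)` on the pushforward is
`Ad(γ(A)⁻¹)(D^A X + D^A D^A ξ)`. The Ricci identity `D^A D^A ξ = [F(A), ξ]` (`covExtDeriv_covDeriv`)
finishes the proof. -/

open scoped Manifold ContDiff Topology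

noncomputable section

namespace GaugeBundle

/-! ### Algebra of the bracket and smoothness of the adjoint action. -/

section LieGroupCalculus

set_option linter.unusedSectionVars false

variable {EH : Type*} [NormedAddCommGroup EH] [NormedSpace ℝ EH]
  {H : Type*} [TopologicalSpace H] [ChartedSpace EH H] [Group H]

section Bracket

variable [LieGroup 𝓘(ℝ, EH) ∞ H]

theorem lieGroup_minSmoothness : LieGroup 𝓘(ℝ, EH) (minSmoothness ℝ 3) H :=
  LieGroup.of_le (n := ∞) (by simp only [minSmoothness_of_isRCLikeNormedField]; exact WithTop.coe_le_coe.2 le_top)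

variable [CompleteSpace EH]

theorem bracket_add_left (X Y Z : EH) :
    bracket H (X + Y) Z = bracket H X Z + bracket H Y Z := by
  have := lieGroup_minSmoothness (EH := EH) (H := H)
  exact add_lie (L := GroupLieAlgebra 𝓘(ℝ, EH) H) (M := GroupLieAlgebra 𝓘(ℝ, EH) H) X Y Z

theorem bracket_add_right (X Y Z : EH) :
    bracket H X (Y + Z) = bracket H X Y + bracket H X Z := by
  have := lieGroup_minSmoothness (EH := EH) (H := H)
  exact lie_add (L := GroupLieAlgebra 𝓘(ℝ, EH) H) (M := GroupLieAlgebra 𝓘(ℝ, EH) H) X Y Z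

theorem bracket_smul_left (a : ℝ) (X Y : EH) :
    bracket H (a • X) Y = a • bracket H X Y := by
  have := lieGroup_minSmoothness (EH := EH) (H := H)
  exact smul_lie (L := GroupLieAlgebra 𝓘(ℝ, EH) H) (M := GroupLieAlgebra 𝓘(ℝ, EH) H) a X Y

theorem bracket_smul_right (a : ℝ) (X Y : EH) :
    bracket H X (a • Y) = a • bracket H X Y := by
  have := lieGroup_minSmoothness (EH := EH) (H := H)
  exact lie_smul (L := GroupLieAlgebra 𝓘(ℝ, EH) H) (M := GroupLieAlgebra 𝓘(ℝ, EH) H) a X Y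

theorem bracket_skew (X Y : EH) : bracket H Y X = -bracket H X Y := by
  have := lieGroup_minSmoothness (EH := EH) (H := H)
  exact (lie_skew (L := GroupLieAlgebra 𝓘(ℝ, EH) H) Y X).symm

theorem bracket_leibniz (X Y Z : EH) :
    bracket H X (bracket H Y Z) = bracket H (bracket H X Y) Z + bracket H Y (bracket H X Z) := by
  have := lieGroup_minSmoothness (EH := EH) (H := H)
  exact LieRing.leibniz_lie (L := GroupLieAlgebra 𝓘(ℝ, EH) H) X Y Z

end Bracket

section FiniteDim

variable [FiniteDimensional ℝ EH] [LieGroup 𝓘(ℝ, EH) ∞ H]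

variable (EH H) in
/-- The bracket of `Lie H` as a continuous bilinear map. -/
def bracketL : EH →L[ℝ] EH →L[ℝ] EH :=
  haveI : CompleteSpace EH := FiniteDimensional.complete ℝ EH
  LinearMap.toContinuousLinearMap
    ((LinearMap.toContinuousLinearMap (𝕜 := ℝ) (E := EH) (F' := EH)).toLinearMap.comp
      (LinearMap.mk₂ ℝ (bracket H) bracket_add_left bracket_smul_left bracket_add_right
        bracket_smul_right))

@[simp]
theorem bracketL_apply (X Y : EH) : bracketL EH H X Y = bracket H X Y := rfl

end FiniteDim

section Adjoint

variable [LieGroup 𝓘(ℝ, EH) ∞ H]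

theorem contMDiff_conj (h : H) : ContMDiff 𝓘(ℝ, EH) 𝓘(ℝ, EH) ∞ (fun k : H => h * k * h⁻¹) :=
  (contMDiff_const.mul contMDiff_id).mul contMDiff_const

theorem mdifferentiableAt_conj (h k : H) :
    MDifferentiableAt 𝓘(ℝ, EH) 𝓘(ℝ, EH) (fun k : H => h * k * h⁻¹) k :=
  (contMDiff_conj h).mdifferentiable (by simp) k

theorem mfderiv_conj_one_eq (h k : H) (hk : k = 1) :
    (mfderiv 𝓘(ℝ, EH) 𝓘(ℝ, EH) (fun k : H => h * k * h⁻¹) k : EH →L[ℝ] EH) =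
      (Ad h : EH →L[ℝ] EH) := by
  subst hk; rfl

theorem Ad_one : (Ad (1 : H) : EH →L[ℝ] EH) = ContinuousLinearMap.id ℝ EH := by
  have : (fun k : H => 1 * k * (1 : H)⁻¹) = id := by ext k; simp
  unfold Ad
  rw [this]
  exact mfderiv_id

theorem Ad_mul (h k : H) : (Ad (h * k) : EH →L[ℝ] EH) = (Ad h).comp (Ad k) := by
  have h1 : (fun l : H => h * k * l * (h * k)⁻¹)
      = (fun l : H => h * l * h⁻¹) ∘ (fun l : H => k * l * k⁻¹) := by
    ext l; simp [mul_assoc]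
  have h2 := mfderiv_comp (I := 𝓘(ℝ, EH)) (I' := 𝓘(ℝ, EH)) (I'' := 𝓘(ℝ, EH)) (1 : H)
    (mdifferentiableAt_conj h (k * 1 * k⁻¹)) (mdifferentiableAt_conj k 1)
  rw [← h1] at h2
  refine h2.trans ?_
  congr 1
  exact mfderiv_conj_one_eq h _ (by simp)

theorem Ad_mul_apply (h k : H) (X : EH) : Ad (h * k) X = Ad h (Ad k X) := by
  rw [Ad_mul]; rfl

theorem Ad_inv_Ad (h : H) (X : EH) : Ad h⁻¹ (Ad h X) = X := by
  rw [← Ad_mul_apply, inv_mul_cancel, Ad_one]; rfl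

theorem Ad_Ad_inv (h : H) (X : EH) : Ad h (Ad h⁻¹ X) = X := by
  rw [← Ad_mul_apply, mul_inv_cancel, Ad_one]; rfl

theorem contMDiff_Ad : ContMDiff 𝓘(ℝ, EH) 𝓘(ℝ, EH →L[ℝ] EH) ∞ (fun h : H => (Ad h : EH →L[ℝ] EH)) := by
  intro h₀
  have : IsManifold 𝓘(ℝ, EH) 1 H := IsManifold.of_le (n := ∞) (by simp)
  have h1 : ContMDiff (𝓘(ℝ, EH).prod 𝓘(ℝ, EH)) 𝓘(ℝ, EH) ∞
      (Function.uncurry (fun h k : H => h * k * h⁻¹)) :=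
    (contMDiff_fst.mul contMDiff_snd).mul contMDiff_fst.inv
  have h2 := ContMDiffAt.mfderiv (m := ∞) (n := ∞) (x₀ := h₀) (fun h k : H => h * k * h⁻¹)
    (fun _ => (1 : H)) (h1 _) contMDiffAt_const (by simp)
  refine h2.congr_of_eventuallyEq (Filter.Eventually.of_forall fun h => ?_)
  rw [inTangentCoordinates_eq_mfderiv_comp (by simp) (by simp)]
  -- Conjugation fixes `1`, so both coordinate changes are derivatives of the preferred chart at `1`
  -- at its own centre, hence the identity. The equalities `e1`, `e2` are only propositional, so
  -- `key` substitutes them with the points as variables.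
  have e1 : h * 1 * h⁻¹ = 1 := by simp
  have e2 : h₀ * 1 * h₀⁻¹ = 1 := by simp
  ext X
  have key : ∀ (a b : H), a = 1 → b = 1 → ∀ Y : EH,
      (mfderiv 𝓘(ℝ, EH) 𝓘(ℝ, EH) (extChartAt 𝓘(ℝ, EH) a) b : EH →L[ℝ] EH) Y = Y := by
    rintro a b rfl rfl Y
    rw [mfderiv_extChartAt_self]; rfl
  have := key _ _ e2 e1
  refine Eq.trans ?_ (this _).symm
  show Ad h X = Ad h _
  congr 1
  have h3 := mfderivWithin_range_extChartAt_symm (I := 𝓘(ℝ, EH)) (x := (1 : H))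
  exact (congrArg (fun L : EH →L[ℝ] EH => L X) h3).symm

end Adjoint

end LieGroupCalculus

/-! ### Derivatives between manifolds as maps of model spaces, and preferred charts. -/

section ChartCalculus

set_option linter.unusedSectionVars false

section Mder

variable {E E' E'' F F' M M' M'' K K' K'' : Type*}
  [NormedAddCommGroup E] [NormedSpace ℝ E] [TopologicalSpace K] {I : ModelWithCorners ℝ E K}
  [TopologicalSpace M] [ChartedSpace K M]
  [NormedAddCommGroup E'] [NormedSpace ℝ E'] [TopologicalSpace K'] {I' : ModelWithCorners ℝ E' K'}
  [TopologicalSpace M'] [ChartedSpace K' M']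
  [NormedAddCommGroup E''] [NormedSpace ℝ E''] [TopologicalSpace K'']
  {I'' : ModelWithCorners ℝ E'' K''} [TopologicalSpace M''] [ChartedSpace K'' M'']
  [NormedAddCommGroup F] [NormedSpace ℝ F] [NormedAddCommGroup F'] [NormedSpace ℝ F']

variable (I I') in
/-- The derivative of a map between manifolds, as a continuous linear map between the model
spaces. -/
def mder (f : M → M') (x : M) : E →L[ℝ] E' := mfderiv I I' f x

theorem mder_comp {g : M' → M''} {f : M → M'} {x : M} {y : M'} (hg : MDifferentiableAt I' I'' g y)
    (hf : MDifferentiableAt I I' f x) (hy : f x = y) :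
    mder I I'' (fun z => g (f z)) x = (mder I' I'' g y).comp (mder I I' f x) := by
  subst hy
  exact mfderiv_comp x hg hf

theorem mder_comp_apply {g : M' → M''} {f : M → M'} {x : M} {y : M'}
    (hg : MDifferentiableAt I' I'' g y)
    (hf : MDifferentiableAt I I' f x) (hy : f x = y) (v : E) :
    mder I I'' (fun z => g (f z)) x v = mder I' I'' g y (mder I I' f x v) := by
  rw [mder_comp hg hf hy]; rfl

theorem mder_id (x : M) : mder I I (fun y : M => y) x = ContinuousLinearMap.id ℝ E := mfderiv_id

theorem mder_const (c : M') (x : M) : mder I I' (fun _ : M => c) x = 0 := mfderiv_const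

theorem mder_eq_fderiv (f : F → F') (x : F) : mder 𝓘(ℝ, F) 𝓘(ℝ, F') f x = fderiv ℝ f x :=
  mfderiv_eq_fderiv

theorem mder_prod_add {f : M × M' → M''} {x : M} {y : M'}
    (hf : MDifferentiableAt (I.prod I') I'' f (x, y)) (v : E) (w : E') :
    mder (I.prod I') I'' f (x, y) (v, w) =
      mder I I'' (fun z => f (z, y)) x v + mder I' I'' (fun z => f (x, z)) y w :=
  mfderiv_prod_eq_add_apply (v := (v, w)) hf

theorem mder_prodMk {f : M → M'} {g : M → M''} {x : M} (hf : MDifferentiableAt I I' f x)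
    (hg : MDifferentiableAt I I'' g x) (v : E) :
    mder I (I'.prod I'') (fun z => (f z, g z)) x v = (mder I I' f x v, mder I I'' g x v) :=
  congrArg (fun L : E →L[ℝ] E' × E'' => L v) (mfderiv_prodMk hf hg)

end Mder

variable {E : Type*} [NormedAddCommGroup E] [NormedSpace ℝ E]
  {N : Type*} [TopologicalSpace N] [ChartedSpace E N]

theorem extChartAt_target_mem_nhds_self (x₀ : N) {y : E}
    (hy : y ∈ (extChartAt 𝓘(ℝ, E) x₀).target) : (extChartAt 𝓘(ℝ, E) x₀).target ∈ 𝓝 y :=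
  (isOpen_extChartAt_target x₀).mem_nhds hy

variable [IsManifold 𝓘(ℝ, E) ∞ N]

theorem contMDiffAt_extChartAt_symm_self (x₀ : N) {y : E}
    (hy : y ∈ (extChartAt 𝓘(ℝ, E) x₀).target) :
    ContMDiffAt 𝓘(ℝ, E) 𝓘(ℝ, E) ∞ (extChartAt 𝓘(ℝ, E) x₀).symm y :=
  (contMDiffOn_extChartAt_symm x₀).contMDiffAt (extChartAt_target_mem_nhds_self x₀ hy)

theorem contMDiffAt_extChartAt_self (x₀ : N) {y : N}
    (hy : y ∈ (extChartAt 𝓘(ℝ, E) x₀).source) :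
    ContMDiffAt 𝓘(ℝ, E) 𝓘(ℝ, E) ∞ (extChartAt 𝓘(ℝ, E) x₀) y :=
  contMDiffAt_extChartAt' (by rwa [extChartAt_source] at hy)

theorem mder_extChartAt_symm_self (x₀ : N) :
    mder 𝓘(ℝ, E) 𝓘(ℝ, E) (extChartAt 𝓘(ℝ, E) x₀).symm (extChartAt 𝓘(ℝ, E) x₀ x₀) =
      ContinuousLinearMap.id ℝ E := by
  have : IsManifold 𝓘(ℝ, E) 1 N := IsManifold.of_le (n := ∞) (by simp)
  have h := mfderivWithin_range_extChartAt_symm (I := 𝓘(ℝ, E)) (x := x₀)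
  simp only [modelWithCornersSelf_coe, Set.range_id, mfderivWithin_univ] at h
  exact h

theorem mder_extChartAt_self (x₀ : N) :
    mder 𝓘(ℝ, E) 𝓘(ℝ, E) (extChartAt 𝓘(ℝ, E) x₀) x₀ = ContinuousLinearMap.id ℝ E := by
  have : IsManifold 𝓘(ℝ, E) 1 N := IsManifold.of_le (n := ∞) (by simp)
  exact mfderiv_extChartAt_self (I := 𝓘(ℝ, E)) (x := x₀)

/-- Pullbacks of vector fields are defined through the total function `inverse`; exhibiting a
two-sided inverse gives its actual value. -/
theorem mfderiv_extChartAt_symm_inverse (x₀ : N) {y : E}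
    (hy : y ∈ (extChartAt 𝓘(ℝ, E) x₀).target) :
    (mfderiv 𝓘(ℝ, E) 𝓘(ℝ, E) (extChartAt 𝓘(ℝ, E) x₀).symm y).inverse =
      mfderiv 𝓘(ℝ, E) 𝓘(ℝ, E) (extChartAt 𝓘(ℝ, E) x₀) ((extChartAt 𝓘(ℝ, E) x₀).symm y) := by
  have : IsManifold 𝓘(ℝ, E) 1 N := IsManifold.of_le (n := ∞) (by simp)
  have h1 := mfderivWithin_extChartAt_symm_comp_mfderiv_extChartAt (I := 𝓘(ℝ, E)) hy
  have h2 := mfderiv_extChartAt_comp_mfderivWithin_extChartAt_symm (I := 𝓘(ℝ, E)) hy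
  simp only [modelWithCornersSelf_coe, Set.range_id, mfderivWithin_univ] at h1 h2
  exact ContinuousLinearMap.inverse_eq h1 h2

end ChartCalculus

/-! ### The Lie bracket through the multiplication read in a chart. -/

section AdjointDerivative

set_option linter.unusedSectionVars false

variable {EH : Type*} [NormedAddCommGroup EH] [NormedSpace ℝ EH]
  {H : Type*} [TopologicalSpace H] [ChartedSpace EH H] [Group H]

variable (EH H) in
/-- The multiplication of `H` read in the preferred chart at `1`. -/
def chartMul (q : EH × EH) : EH :=
  extChartAt 𝓘(ℝ, EH) (1 : H)
    ((extChartAt 𝓘(ℝ, EH) (1 : H)).symm q.1 * (extChartAt 𝓘(ℝ, EH) (1 : H)).symm q.2)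

variable (EH H) in
/-- The coordinates of `1` in the preferred chart at `1`. -/
def chartOne : EH := extChartAt 𝓘(ℝ, EH) (1 : H) 1

theorem chartOne_mem : chartOne EH H ∈ (extChartAt 𝓘(ℝ, EH) (1 : H)).target :=
  mem_extChartAt_target 1

theorem symm_chartOne : (extChartAt 𝓘(ℝ, EH) (1 : H)).symm (chartOne EH H) = 1 :=
  extChartAt_to_inv 1

theorem chartMul_one_right {a : EH} (ha : a ∈ (extChartAt 𝓘(ℝ, EH) (1 : H)).target) :
    chartMul EH H (a, chartOne EH H) = a := by
  simp only [chartMul, symm_chartOne, mul_one]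
  exact (extChartAt 𝓘(ℝ, EH) (1 : H)).right_inv ha

theorem chartMul_one_left {a : EH} (ha : a ∈ (extChartAt 𝓘(ℝ, EH) (1 : H)).target) :
    chartMul EH H (chartOne EH H, a) = a := by
  simp only [chartMul, symm_chartOne, one_mul]
  exact (extChartAt 𝓘(ℝ, EH) (1 : H)).right_inv ha

variable [LieGroup 𝓘(ℝ, EH) ∞ H]

theorem contDiffAt_chartMul {a b : EH} (ha : a ∈ (extChartAt 𝓘(ℝ, EH) (1 : H)).target)
    (hb : b ∈ (extChartAt 𝓘(ℝ, EH) (1 : H)).target)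
    (hab : (extChartAt 𝓘(ℝ, EH) (1 : H)).symm a * (extChartAt 𝓘(ℝ, EH) (1 : H)).symm b ∈
      (extChartAt 𝓘(ℝ, EH) (1 : H)).source) :
    ContDiffAt ℝ ∞ (chartMul EH H) (a, b) := by
  rw [← contMDiffAt_iff_contDiffAt]
  have h1 : ContMDiffAt 𝓘(ℝ, EH × EH) 𝓘(ℝ, EH) ∞
      (fun q : EH × EH => (extChartAt 𝓘(ℝ, EH) (1 : H)).symm q.1) (a, b) :=
    (contMDiffAt_extChartAt_symm_self (1 : H) ha).comp (a, b) contDiff_fst.contMDiff.contMDiffAt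
  have h2 : ContMDiffAt 𝓘(ℝ, EH × EH) 𝓘(ℝ, EH) ∞
      (fun q : EH × EH => (extChartAt 𝓘(ℝ, EH) (1 : H)).symm q.2) (a, b) :=
    (contMDiffAt_extChartAt_symm_self (1 : H) hb).comp (a, b) contDiff_snd.contMDiff.contMDiffAt
  exact ContMDiffAt.comp (a, b) (contMDiffAt_extChartAt_self (1 : H) hab) (h1.mul h2)

theorem contDiffAt_chartMul_one :
    ContDiffAt ℝ ∞ (chartMul EH H) (chartOne EH H, chartOne EH H) :=
  contDiffAt_chartMul chartOne_mem chartOne_mem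
    (by rw [symm_chartOne, one_mul]; exact mem_extChartAt_source 1)

theorem contDiffAt_chartMul_right {a : EH} (ha : a ∈ (extChartAt 𝓘(ℝ, EH) (1 : H)).target) :
    ContDiffAt ℝ ∞ (chartMul EH H) (a, chartOne EH H) :=
  contDiffAt_chartMul ha chartOne_mem
    (by rw [symm_chartOne, mul_one]; exact (extChartAt 𝓘(ℝ, EH) (1 : H)).map_target ha)

theorem contDiffAt_chartMul_left {a : EH} (ha : a ∈ (extChartAt 𝓘(ℝ, EH) (1 : H)).target) :
    ContDiffAt ℝ ∞ (chartMul EH H) (chartOne EH H, a) :=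
  contDiffAt_chartMul chartOne_mem ha
    (by rw [symm_chartOne, one_mul]; exact (extChartAt 𝓘(ℝ, EH) (1 : H)).map_target ha)

theorem fderiv_chartMul_inr {a : EH} (ha : a ∈ (extChartAt 𝓘(ℝ, EH) (1 : H)).target) (Y : EH) :
    fderiv ℝ (chartMul EH H) (a, chartOne EH H) (0, Y) =
      mder 𝓘(ℝ, EH) 𝓘(ℝ, EH) (fun k : H => extChartAt 𝓘(ℝ, EH) (1 : H)
        ((extChartAt 𝓘(ℝ, EH) (1 : H)).symm a * k)) 1 Y := by
  have hm := (contDiffAt_chartMul_right ha).differentiableAt (by simp)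
  have h1 : fderiv ℝ (fun b => chartMul EH H (a, b)) (chartOne EH H) Y =
      fderiv ℝ (chartMul EH H) (a, chartOne EH H) (0, Y) := by
    have := hm.hasFDerivAt.comp (chartOne EH H) (hasFDerivAt_prodMk_right a (chartOne EH H))
    exact congrArg (fun L : EH →L[ℝ] EH => L Y) this.fderiv
  have hs : MDifferentiableAt 𝓘(ℝ, EH) 𝓘(ℝ, EH) (fun k : H => extChartAt 𝓘(ℝ, EH) (1 : H)
        ((extChartAt 𝓘(ℝ, EH) (1 : H)).symm a * k)) 1 := by
    refine ContMDiffAt.mdifferentiableAt (n := ∞) ?_ (by simp)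
    refine ContMDiffAt.comp _ (contMDiffAt_extChartAt_self (1 : H) ?_)
      (contMDiffAt_const.mul contMDiffAt_id)
    simp only [mul_one]
    exact (extChartAt 𝓘(ℝ, EH) (1 : H)).map_target ha
  have h2 := mder_comp (x := chartOne EH H) hs
    ((contMDiffAt_extChartAt_symm_self (1 : H) chartOne_mem).mdifferentiableAt (by simp))
    symm_chartOne
  rw [show chartOne EH H = extChartAt 𝓘(ℝ, EH) (1 : H) 1 from rfl,
    mder_extChartAt_symm_self, ContinuousLinearMap.comp_id] at h2
  rw [← h1, ← mder_eq_fderiv, ← h2]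
  rfl

/-- A left-invariant field at `h` is the derivative of `k ↦ h k` at `k = 1`, which in coordinates is
a partial derivative of the multiplication in its second argument. -/
theorem mpullback_mulInvariantVectorField_chart {a : EH}
    (ha : a ∈ (extChartAt 𝓘(ℝ, EH) (1 : H)).target) (Y : EH) :
    (VectorField.mpullback 𝓘(ℝ, EH) 𝓘(ℝ, EH) (extChartAt 𝓘(ℝ, EH) (1 : H)).symm
      (mulInvariantVectorField (I := 𝓘(ℝ, EH)) (G := H) Y) a : EH) =
      fderiv ℝ (chartMul EH H) (a, chartOne EH H) (0, Y) := by
  rw [fderiv_chartMul_inr ha, VectorField.mpullback_apply, mfderiv_extChartAt_symm_inverse _ ha]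
  have hm := (extChartAt 𝓘(ℝ, EH) (1 : H)).map_target ha
  have h2 := mder_comp (x := (1 : H))
    ((contMDiffAt_extChartAt_self (1 : H) hm).mdifferentiableAt (by simp))
    ((contMDiff_const.mul contMDiff_id).mdifferentiable (n := ∞) (by simp) (1 : H)) (mul_one _)
  exact (congrArg (fun L : EH →L[ℝ] EH => L Y) h2).symm

/-- The bracket of two vector fields in coordinates is the difference of their cross derivatives.
For left-invariant fields, whose values at `1` are `X` and `Y`, this leaves mixed second derivatives
of the multiplication. -/
theorem bracket_eq_fderiv_chartMul (X Y : EH) :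
    bracket H X Y =
      fderiv ℝ (fun a => fderiv ℝ (chartMul EH H) (a, chartOne EH H) (0, Y)) (chartOne EH H) X -
      fderiv ℝ (fun a => fderiv ℝ (chartMul EH H) (a, chartOne EH H) (0, X)) (chartOne EH H) Y := by
  have hid : ∀ Z : EH, fderiv ℝ (chartMul EH H) (chartOne EH H, chartOne EH H) (0, Z) = Z := by
    intro Z
    have h1 := (contDiffAt_chartMul_one (EH := EH) (H := H)).differentiableAt (by simp)
    have h2 := h1.hasFDerivAt.comp (chartOne EH H)
      (hasFDerivAt_prodMk_right (chartOne EH H) (chartOne EH H))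
    have h3 : HasFDerivAt (fun b => chartMul EH H (chartOne EH H, b))
        (ContinuousLinearMap.id ℝ EH) (chartOne EH H) :=
      (hasFDerivAt_id _).congr_of_eventuallyEq (Filter.eventuallyEq_of_mem
        (extChartAt_target_mem_nhds_self (1 : H) chartOne_mem) fun a ha => chartMul_one_left ha)
    exact congrArg (fun L : EH →L[ℝ] EH => L Z) (h2.unique h3)
  have hev : ∀ Z : EH, (VectorField.mpullback 𝓘(ℝ, EH) 𝓘(ℝ, EH) (extChartAt 𝓘(ℝ, EH) (1 : H)).symm
      (mulInvariantVectorField (I := 𝓘(ℝ, EH)) (G := H) Z) : EH → EH) =ᶠ[𝓝 (chartOne EH H)]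
      fun a => fderiv ℝ (chartMul EH H) (a, chartOne EH H) (0, Z) := fun Z =>
    Filter.eventuallyEq_of_mem (extChartAt_target_mem_nhds_self (1 : H) chartOne_mem)
      fun a ha => mpullback_mulInvariantVectorField_chart ha Z
  have h0 : bracket H X Y = VectorField.lieBracket ℝ
      (VectorField.mpullback 𝓘(ℝ, EH) 𝓘(ℝ, EH) (extChartAt 𝓘(ℝ, EH) (1 : H)).symm
        (mulInvariantVectorField (I := 𝓘(ℝ, EH)) (G := H) X) : EH → EH)
      (VectorField.mpullback 𝓘(ℝ, EH) 𝓘(ℝ, EH) (extChartAt 𝓘(ℝ, EH) (1 : H)).symm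
        (mulInvariantVectorField (I := 𝓘(ℝ, EH)) (G := H) Y) : EH → EH) (chartOne EH H) := by
    have h1 : bracket H X Y = VectorField.mlieBracketWithin 𝓘(ℝ, EH)
      (mulInvariantVectorField (I := 𝓘(ℝ, EH)) (G := H) X)
      (mulInvariantVectorField (I := 𝓘(ℝ, EH)) (G := H) Y) Set.univ (1 : H) := rfl
    rw [h1, VectorField.mlieBracketWithin_apply]
    have h2 : ∀ (L : EH →L[ℝ] EH) (Z : EH), L = ContinuousLinearMap.id ℝ EH → L.inverse Z = Z := by
      rintro L Z rfl
      rw [ContinuousLinearMap.inverse_id]; rfl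
    refine (h2 _ _ (mder_extChartAt_self (E := EH) (1 : H))).trans ?_
    simp only [Set.preimage_univ, modelWithCornersSelf_coe, Set.range_id, Set.inter_univ,
      VectorField.mpullbackWithin_univ]
    exact congrFun VectorField.lieBracketWithin_univ _
  rw [h0, (hev X).lieBracket_vectorField_eq (hev Y)]
  simp only [VectorField.lieBracket, hid]

end AdjointDerivative

/-! ### The derivative of the adjoint action at the identity. -/

section AdjointDerivative

set_option linter.unusedSectionVars false

variable {EH : Type*} [NormedAddCommGroup EH] [NormedSpace ℝ EH]
  {H : Type*} [TopologicalSpace H] [ChartedSpace EH H] [Group H]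
  [LieGroup 𝓘(ℝ, EH) ∞ H]

theorem fderiv_chartMul_inl {a : EH} (ha : a ∈ (extChartAt 𝓘(ℝ, EH) (1 : H)).target) (Y : EH) :
    fderiv ℝ (chartMul EH H) (chartOne EH H, a) (Y, 0) =
      mder 𝓘(ℝ, EH) 𝓘(ℝ, EH) (fun k : H => extChartAt 𝓘(ℝ, EH) (1 : H)
        (k * (extChartAt 𝓘(ℝ, EH) (1 : H)).symm a)) 1 Y := by
  have hm := (contDiffAt_chartMul_left ha).differentiableAt (by simp)
  have h1 : fderiv ℝ (fun b => chartMul EH H (b, a)) (chartOne EH H) Y =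
      fderiv ℝ (chartMul EH H) (chartOne EH H, a) (Y, 0) := by
    have := HasFDerivAt.comp (f := fun b => (b, a)) (chartOne EH H) hm.hasFDerivAt
      (hasFDerivAt_prodMk_left (chartOne EH H) a)
    exact congrArg (fun L : EH →L[ℝ] EH => L Y) this.fderiv
  have hs : MDifferentiableAt 𝓘(ℝ, EH) 𝓘(ℝ, EH) (fun k : H => extChartAt 𝓘(ℝ, EH) (1 : H)
        (k * (extChartAt 𝓘(ℝ, EH) (1 : H)).symm a)) 1 := by
    refine ContMDiffAt.mdifferentiableAt (n := ∞) ?_ (by simp)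
    refine ContMDiffAt.comp _ (contMDiffAt_extChartAt_self (1 : H) ?_)
      (contMDiffAt_id.mul contMDiffAt_const)
    simp only [one_mul]
    exact (extChartAt 𝓘(ℝ, EH) (1 : H)).map_target ha
  have h2 := mder_comp (x := chartOne EH H) hs
    ((contMDiffAt_extChartAt_symm_self (1 : H) chartOne_mem).mdifferentiableAt (by simp))
    symm_chartOne
  rw [show chartOne EH H = extChartAt 𝓘(ℝ, EH) (1 : H) 1 from rfl,
    mder_extChartAt_symm_self, ContinuousLinearMap.comp_id] at h2
  rw [← h1, ← mder_eq_fderiv, ← h2]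
  rfl

/-- The derivative at `k = 1` of the identity `(h k h⁻¹) h = h k`. -/
theorem fderiv_chartMul_Ad {a : EH} (ha : a ∈ (extChartAt 𝓘(ℝ, EH) (1 : H)).target) (Y : EH) :
    fderiv ℝ (chartMul EH H) (chartOne EH H, a)
      (Ad ((extChartAt 𝓘(ℝ, EH) (1 : H)).symm a) Y, 0) =
      fderiv ℝ (chartMul EH H) (a, chartOne EH H) (0, Y) := by
  rw [fderiv_chartMul_inl ha, fderiv_chartMul_inr ha]
  set h := (extChartAt 𝓘(ℝ, EH) (1 : H)).symm a with hh
  have hs : MDifferentiableAt 𝓘(ℝ, EH) 𝓘(ℝ, EH) (fun k : H => extChartAt 𝓘(ℝ, EH) (1 : H)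
        (k * h)) 1 := by
    refine ContMDiffAt.mdifferentiableAt (n := ∞) ?_ (by simp)
    refine ContMDiffAt.comp _ (contMDiffAt_extChartAt_self (1 : H) ?_)
      (contMDiffAt_id.mul contMDiffAt_const)
    simp only [one_mul]
    exact (extChartAt 𝓘(ℝ, EH) (1 : H)).map_target ha
  have h2 := mder_comp_apply hs (mdifferentiableAt_conj h 1) (by simp) Y
  simp only [inv_mul_cancel_right] at h2
  exact h2.symm

theorem fderiv_chartMul_one (Y Z : EH) :
    fderiv ℝ (chartMul EH H) (chartOne EH H, chartOne EH H) (Y, Z) = Y + Z := by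
  have h1 := (contDiffAt_chartMul_one (EH := EH) (H := H)).differentiableAt (by simp)
  have h2 := h1.hasFDerivAt.comp (chartOne EH H)
    (hasFDerivAt_prodMk_right (chartOne EH H) (chartOne EH H))
  have h3 : HasFDerivAt (fun b => chartMul EH H (chartOne EH H, b))
      (ContinuousLinearMap.id ℝ EH) (chartOne EH H) :=
    (hasFDerivAt_id _).congr_of_eventuallyEq (Filter.eventuallyEq_of_mem
      (extChartAt_target_mem_nhds_self (1 : H) chartOne_mem) fun a ha => chartMul_one_left ha)
  have h4 := HasFDerivAt.comp (f := fun b => (b, chartOne EH H)) (chartOne EH H) h1.hasFDerivAt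
    (hasFDerivAt_prodMk_left (chartOne EH H) (chartOne EH H))
  have h5 : HasFDerivAt (fun b => chartMul EH H (b, chartOne EH H))
      (ContinuousLinearMap.id ℝ EH) (chartOne EH H) :=
    (hasFDerivAt_id _).congr_of_eventuallyEq (Filter.eventuallyEq_of_mem
      (extChartAt_target_mem_nhds_self (1 : H) chartOne_mem) fun a ha => chartMul_one_right ha)
  have e1 := congrArg (fun L : EH →L[ℝ] EH => L Z) (h2.unique h3)
  have e2 := congrArg (fun L : EH →L[ℝ] EH => L Y) (h4.unique h5)
  have e3 : ((Y, Z) : EH × EH) = (Y, 0) + (0, Z) := by simp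
  rw [e3, map_add]
  exact congrArg₂ (· + ·) e2 e1

theorem contDiffAt_Ad_chart {a : EH} (ha : a ∈ (extChartAt 𝓘(ℝ, EH) (1 : H)).target) :
    ContDiffAt ℝ ∞ (fun a => (Ad ((extChartAt 𝓘(ℝ, EH) (1 : H)).symm a) : EH →L[ℝ] EH)) a := by
  rw [← contMDiffAt_iff_contDiffAt]
  exact (contMDiff_Ad _).comp a (contMDiffAt_extChartAt_symm_self (1 : H) ha)

/-- The derivative of the adjoint action at `1` is the bracket. -/
theorem fderiv_Ad_chart (X Y : EH) :
    fderiv ℝ (fun a => (Ad ((extChartAt 𝓘(ℝ, EH) (1 : H)).symm a) : EH →L[ℝ] EH))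
      (chartOne EH H) X Y = bracket H X Y := by
  set m := chartMul EH H with hm
  set e := chartOne EH H with he
  have hC : ContDiffAt ℝ ∞ m (e, e) := contDiffAt_chartMul_one
  have hD : DifferentiableAt ℝ (fderiv ℝ m) (e, e) :=
    (hC.fderiv_right (m := ∞) (by simp)).differentiableAt (by simp)
  set Q := fderiv ℝ (fderiv ℝ m) (e, e) with hQ
  have hsymm : ∀ u v, Q u v = Q v u :=
    (hC.isSymmSndFDerivAt (by
      rw [minSmoothness_of_isRCLikeNormedField]; exact WithTop.coe_le_coe.2 le_top)).eq
  obtain ⟨A, hAdef⟩ : ∃ A : EH → EH →L[ℝ] EH, A = fun a =>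
    Ad ((extChartAt 𝓘(ℝ, EH) (1 : H)).symm a) := ⟨_, rfl⟩
  have hone : A e = .id ℝ EH := by
    simp only [hAdef, he, symm_chartOne, Ad_one]
  have hA : HasFDerivAt A (fderiv ℝ A e) e := by
    rw [hAdef]
    exact ((contDiffAt_Ad_chart (H := H) (chartOne_mem (EH := EH))).differentiableAt
      (by simp)).hasFDerivAt
  rw [← hAdef]
  have hr : ∀ Z : EH, HasFDerivAt (fun a => fderiv ℝ m (a, e) (0, Z))
      ((ContinuousLinearMap.apply ℝ EH ((0, Z) : EH × EH)).comp
        (Q.comp (ContinuousLinearMap.inl ℝ EH EH))) e := fun Z =>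
    (ContinuousLinearMap.apply ℝ EH ((0, Z) : EH × EH)).hasFDerivAt.comp e
      (HasFDerivAt.comp (f := fun b => (b, e)) e hD.hasFDerivAt (hasFDerivAt_prodMk_left e e))
  have hl := (hD.hasFDerivAt.comp e (hasFDerivAt_prodMk_right e e)).clm_apply
    ((hA.clm_apply (hasFDerivAt_const Y e)).prodMk (hasFDerivAt_const (0 : EH) e))
  have hev : (fun a => fderiv ℝ m (e, a) (A a Y, 0)) =ᶠ[𝓝 e]
      fun a => fderiv ℝ m (a, e) (0, Y) := by
    rw [hAdef]
    exact Filter.eventuallyEq_of_mem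
      (extChartAt_target_mem_nhds_self (1 : H) chartOne_mem) fun a ha => fderiv_chartMul_Ad ha Y
  -- Differentiating `∂₁m(e,a)(Ad(a)Y) = ∂₂m(a,e)Y` at `a = e` in the direction `X` gives
  -- `Q(0,X)(Y,0) + (D_X Ad)Y = Q(X,0)(0,Y)`. By symmetry of `Q` the first term is `Q(Y,0)(0,X)`, so
  -- `(D_X Ad)Y` is the coordinate expression of the bracket.
  have h1 := congrArg (fun L : EH →L[ℝ] EH => L X) (hl.unique ((hr Y).congr_of_eventuallyEq hev))
  have hX := congrArg (fun L : EH →L[ℝ] EH => L Y) (hr X).fderiv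
  have hY := congrArg (fun L : EH →L[ℝ] EH => L X) (hr Y).fderiv
  have hone' : ∀ Z W, fderiv ℝ m (e, e) (Z, W) = Z + W := fderiv_chartMul_one
  simp [hone, hone'] at h1 hX hY
  rw [bracket_eq_fderiv_chartMul, hX, hY, hsymm (Y, 0) (0, X), ← h1, ← hQ]
  abel

end AdjointDerivative

/-! ### Exchange of a parameter derivative with a spatial derivative. -/

section MixedPartials

variable {E F : Type*} [NormedAddCommGroup E] [NormedSpace ℝ E] [NormedAddCommGroup F]
  [NormedSpace ℝ F]

theorem hasDerivAt_fderiv_mixed {f : ℝ → E → F} {x₀ : E}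
    (hf : ContDiffAt ℝ ∞ (Function.uncurry f) (0, x₀)) (v : E) :
    HasDerivAt (fun τ => fderiv ℝ (f τ) x₀ v)
      (fderiv ℝ (fun x => deriv (fun τ => f τ x) 0) x₀ v) 0 := by
  have hev : ∀ᶠ q in 𝓝 ((0 : ℝ), x₀), DifferentiableAt ℝ (Function.uncurry f) q :=
    ((hf.of_le (m := 1) (by simp)).eventually (by simp)).mono
      fun q hq => hq.differentiableAt (by simp)
  have hD : HasFDerivAt (fderiv ℝ (Function.uncurry f))
      (fderiv ℝ (fderiv ℝ (Function.uncurry f)) (0, x₀)) (0, x₀) :=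
    ((hf.fderiv_right (m := ∞) (by simp)).differentiableAt (by simp)).hasFDerivAt
  have hsymm : ∀ u v, fderiv ℝ (fderiv ℝ (Function.uncurry f)) (0, x₀) u v =
      fderiv ℝ (fderiv ℝ (Function.uncurry f)) (0, x₀) v u :=
    (hf.isSymmSndFDerivAt (by
      rw [minSmoothness_of_isRCLikeNormedField]; exact WithTop.coe_le_coe.2 le_top)).eq
  have h1 : (fun τ => fderiv ℝ (f τ) x₀ v) =ᶠ[𝓝 0]
      fun τ => fderiv ℝ (Function.uncurry f) (τ, x₀) (0, v) := by
    have hc : Filter.Tendsto (fun τ : ℝ => (τ, x₀)) (𝓝 0) (𝓝 (0, x₀)) :=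
      (Continuous.prodMk_left x₀).tendsto 0
    filter_upwards [hc.eventually hev] with τ hτ
    have := HasFDerivAt.comp (f := fun y => (τ, y)) x₀ hτ.hasFDerivAt (hasFDerivAt_prodMk_right τ x₀)
    exact congrArg (fun L : E →L[ℝ] F => L v) this.fderiv
  have h2 : (fun x => deriv (fun τ => f τ x) 0) =ᶠ[𝓝 x₀]
      fun x => fderiv ℝ (Function.uncurry f) (0, x) (1, 0) := by
    have hc : Filter.Tendsto (fun x : E => ((0 : ℝ), x)) (𝓝 x₀) (𝓝 (0, x₀)) :=
      (Continuous.prodMk_right 0).tendsto x₀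
    filter_upwards [hc.eventually hev] with x hx
    have := HasFDerivAt.comp (f := fun τ => (τ, x)) 0 hx.hasFDerivAt (hasFDerivAt_prodMk_left 0 x)
    exact this.hasDerivAt.deriv
  have h3 : HasFDerivAt (fun τ => fderiv ℝ (Function.uncurry f) (τ, x₀) (0, v)) _ 0 :=
    (ContinuousLinearMap.apply ℝ F ((0, v) : ℝ × E)).hasFDerivAt.comp (0 : ℝ)
      (HasFDerivAt.comp (f := fun τ => (τ, x₀)) 0 hD (hasFDerivAt_prodMk_left 0 x₀))
  have h4 : HasFDerivAt (fun x => fderiv ℝ (Function.uncurry f) (0, x) (1, 0)) _ x₀ :=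
    (ContinuousLinearMap.apply ℝ F ((1, 0) : ℝ × E)).hasFDerivAt.comp x₀
      (HasFDerivAt.comp (f := fun x => ((0 : ℝ), x)) x₀ hD (hasFDerivAt_prodMk_right 0 x₀))
  rw [h2.fderiv_eq, h4.fderiv]
  have h5 := (h3.hasDerivAt.congr_of_eventuallyEq h1)
  refine h5.congr_deriv ?_
  exact hsymm (1, 0) (0, v)

end MixedPartials

/-! ### Derivatives of `Ad(g)` and of the Maurer-Cartan form along maps to the group. -/

section AdjointCalculus

set_option linter.unusedSectionVars false

variable {EH : Type*} [NormedAddCommGroup EH] [NormedSpace ℝ EH]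
  {H : Type*} [TopologicalSpace H] [ChartedSpace EH H] [Group H]
  [LieGroup 𝓘(ℝ, EH) ∞ H]
  {E : Type*} [NormedAddCommGroup E] [NormedSpace ℝ E]

theorem mdifferentiableAt_mul_left (h k : H) :
    MDifferentiableAt 𝓘(ℝ, EH) 𝓘(ℝ, EH) (fun l : H => h * l) k :=
  ((contMDiff_const.mul contMDiff_id).mdifferentiable (n := ∞) (by simp)) k

/-- The left Maurer-Cartan form of `H` at `h`. -/
def maurerCartan (h : H) : EH →L[ℝ] EH :=
  mder 𝓘(ℝ, EH) 𝓘(ℝ, EH) (fun k : H => h⁻¹ * k) h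

theorem maurerCartan_one : (maurerCartan (1 : H) : EH →L[ℝ] EH) = .id ℝ EH := by
  simp only [maurerCartan, inv_one, one_mul]
  exact mder_id _

/-- Velocities at `1` can be read in the preferred chart at `1`. -/
theorem fderiv_chart_comp {k : E → H} {x₀ : E} (hk : MDifferentiableAt 𝓘(ℝ, E) 𝓘(ℝ, EH) k x₀)
    (h1 : k x₀ = 1) :
    fderiv ℝ (fun x => extChartAt 𝓘(ℝ, EH) (1 : H) (k x)) x₀ = mder 𝓘(ℝ, E) 𝓘(ℝ, EH) k x₀ := by
  rw [← mder_eq_fderiv, mder_comp (y := (1 : H)) (((contMDiffAt_extChartAt_self (1 : H)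
    (mem_extChartAt_source 1))).mdifferentiableAt (by simp)) hk h1, mder_extChartAt_self,
    ContinuousLinearMap.id_comp]

theorem differentiableAt_chart_comp {k : E → H} {x₀ : E}
    (hk : MDifferentiableAt 𝓘(ℝ, E) 𝓘(ℝ, EH) k x₀) (h1 : k x₀ = 1) :
    DifferentiableAt ℝ (fun x => extChartAt 𝓘(ℝ, EH) (1 : H) (k x)) x₀ := by
  rw [← mdifferentiableAt_iff_differentiableAt]
  refine MDifferentiableAt.comp x₀ (ContMDiffAt.mdifferentiableAt (n := ∞)
    (contMDiffAt_extChartAt_self (1 : H) ?_) (by simp)) hk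
  rw [h1]; exact mem_extChartAt_source 1

theorem differentiableAt_Ad_comp {g : E → H} {x₀ : E}
    (hg : MDifferentiableAt 𝓘(ℝ, E) 𝓘(ℝ, EH) g x₀) :
    DifferentiableAt ℝ (fun x => (Ad (g x) : EH →L[ℝ] EH)) x₀ := by
  rw [← mdifferentiableAt_iff_differentiableAt]
  exact MDifferentiableAt.comp x₀ (contMDiff_Ad.mdifferentiable (by simp) _) hg

theorem mder_mul_one {E' K' M' : Type*} [NormedAddCommGroup E'] [NormedSpace ℝ E']
    [TopologicalSpace K'] {I' : ModelWithCorners ℝ E' K'} [TopologicalSpace M'] [ChartedSpace K' M']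
    {a b : M' → H} {x : M'} (ha : MDifferentiableAt I' 𝓘(ℝ, EH) a x)
    (hb : MDifferentiableAt I' 𝓘(ℝ, EH) b x) (ha1 : a x = 1) (hb1 : b x = 1) :
    mder I' 𝓘(ℝ, EH) (fun t => a t * b t) x =
      mder I' 𝓘(ℝ, EH) a x + mder I' 𝓘(ℝ, EH) b x := by
  have hm : MDifferentiableAt (𝓘(ℝ, EH).prod 𝓘(ℝ, EH)) 𝓘(ℝ, EH)
      (fun q : H × H => q.1 * q.2) (1, 1) :=
    (contMDiff_mul 𝓘(ℝ, EH) ∞).mdifferentiable (by simp) _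
  ext v
  rw [mder_comp_apply (f := fun t => (a t, b t)) hm (ha.prodMk hb) (by rw [ha1, hb1]),
    mder_prodMk ha hb, mder_prod_add hm]
  simp only [mul_one, one_mul, mder_id]
  rfl

theorem mdifferentiableAt_inv_mul {E' K' M' : Type*} [NormedAddCommGroup E'] [NormedSpace ℝ E']
    [TopologicalSpace K'] {I' : ModelWithCorners ℝ E' K'} [TopologicalSpace M'] [ChartedSpace K' M']
    {a b : M' → H} {x : M'} (ha : MDifferentiableAt I' 𝓘(ℝ, EH) a x)
    (hb : MDifferentiableAt I' 𝓘(ℝ, EH) b x) :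
    MDifferentiableAt I' 𝓘(ℝ, EH) (fun t => (a t)⁻¹ * b t) x :=
  MDifferentiableAt.comp (g := fun q : H × H => q.1⁻¹ * q.2) x
    (((contMDiff_fst (I := 𝓘(ℝ, EH)) (J := 𝓘(ℝ, EH)) (n := ∞)).inv.mul
      contMDiff_snd).mdifferentiable (by simp) (a x, b x))
    (ha.prodMk hb)

/-- Follows from the product rule at `1` applied to `a · (a⁻¹ b) = b`, with no need to differentiate
the inversion. -/
theorem mder_inv_mul_one {E' K' M' : Type*} [NormedAddCommGroup E'] [NormedSpace ℝ E']
    [TopologicalSpace K'] {I' : ModelWithCorners ℝ E' K'} [TopologicalSpace M'] [ChartedSpace K' M']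
    {a b : M' → H} {x : M'} (ha : MDifferentiableAt I' 𝓘(ℝ, EH) a x)
    (hb : MDifferentiableAt I' 𝓘(ℝ, EH) b x) (ha1 : a x = 1) (hb1 : b x = 1) :
    mder I' 𝓘(ℝ, EH) (fun t => (a t)⁻¹ * b t) x =
      mder I' 𝓘(ℝ, EH) b x - mder I' 𝓘(ℝ, EH) a x := by
  have h1 := mder_mul_one ha (mdifferentiableAt_inv_mul ha hb) ha1 (by simp [ha1, hb1])
  simp only [mul_inv_cancel_left] at h1
  rw [h1]; abel

variable [FiniteDimensional ℝ EH]

theorem hasFDerivAt_Ad_comp_one {k : E → H} {x₀ : E}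
    (hk : MDifferentiableAt 𝓘(ℝ, E) 𝓘(ℝ, EH) k x₀) (h1 : k x₀ = 1) :
    HasFDerivAt (fun x => (Ad (k x) : EH →L[ℝ] EH))
      ((bracketL EH H).comp (mder 𝓘(ℝ, E) 𝓘(ℝ, EH) k x₀)) x₀ := by
  have hd : HasFDerivAt (fun a => (Ad ((extChartAt 𝓘(ℝ, EH) (1 : H)).symm a) : EH →L[ℝ] EH))
      (bracketL EH H) (chartOne EH H) := by
    have h := ((contDiffAt_Ad_chart (EH := EH) (H := H) chartOne_mem).differentiableAt
      (by simp)).hasFDerivAt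
    refine h.congr_fderiv ?_
    ext X Y
    exact fderiv_Ad_chart X Y
  have he : extChartAt 𝓘(ℝ, EH) (1 : H) (k x₀) = chartOne EH H := by rw [h1]; rfl
  rw [← he] at hd
  have h2 := hd.comp x₀ (differentiableAt_chart_comp hk h1).hasFDerivAt
  rw [fderiv_chart_comp hk h1] at h2
  refine h2.congr_of_eventuallyEq ?_
  have h3 : (extChartAt 𝓘(ℝ, EH) (1 : H)).source ∈ 𝓝 (k x₀) := by
    rw [h1]; exact extChartAt_source_mem_nhds 1
  filter_upwards [hk.continuousAt.preimage_mem_nhds h3] with x hx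
  simp only [Function.comp_def]
  rw [(extChartAt 𝓘(ℝ, EH) (1 : H)).left_inv hx]

/-- The derivative of `Ad` is known only for maps through `1`, so `Ad(g⁻¹)Z` is multiplied by
`Ad(g(x₀)⁻¹ g)`. The product is `Ad(g(x₀)⁻¹)Z`, whose derivative is immediate, and the product rule
can be solved for the unknown derivative. -/
theorem hasFDerivAt_Ad_inv {g : E → H} {x₀ : E} (hg : MDifferentiableAt 𝓘(ℝ, E) 𝓘(ℝ, EH) g x₀)
    {Z : E → EH} {Z' : E →L[ℝ] EH} (hZ : HasFDerivAt Z Z' x₀) :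
    HasFDerivAt (fun x => Ad (g x)⁻¹ (Z x))
      ((Ad (g x₀)⁻¹).comp Z' - ((bracketL EH H).flip (Ad (g x₀)⁻¹ (Z x₀))).comp
        ((maurerCartan (g x₀)).comp (mder 𝓘(ℝ, E) 𝓘(ℝ, EH) g x₀))) x₀ := by
  have hgi : MDifferentiableAt 𝓘(ℝ, E) 𝓘(ℝ, EH) (fun x => (g x)⁻¹) x₀ :=
    MDifferentiableAt.comp x₀ ((contMDiff_inv 𝓘(ℝ, EH) ∞).mdifferentiable (by simp) _) hg
  have hQ := ((differentiableAt_Ad_comp hgi).clm_apply hZ.differentiableAt).hasFDerivAt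
  have hk : MDifferentiableAt 𝓘(ℝ, E) 𝓘(ℝ, EH) (fun x => (g x₀)⁻¹ * g x) x₀ :=
    MDifferentiableAt.comp x₀ (mdifferentiableAt_mul_left (g x₀)⁻¹ (g x₀)) hg
  have hkd : mder 𝓘(ℝ, E) 𝓘(ℝ, EH) (fun x => (g x₀)⁻¹ * g x) x₀ =
      (maurerCartan (g x₀)).comp (mder 𝓘(ℝ, E) 𝓘(ℝ, EH) g x₀) :=
    mder_comp (mdifferentiableAt_mul_left (g x₀)⁻¹ (g x₀)) hg rfl
  have h1 := (hasFDerivAt_Ad_comp_one hk (inv_mul_cancel _)).clm_apply hQ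
  have h2 : (fun x => Ad ((g x₀)⁻¹ * g x) (Ad (g x)⁻¹ (Z x))) = fun x => Ad (g x₀)⁻¹ (Z x) := by
    funext x
    rw [Ad_mul_apply, Ad_Ad_inv]
  rw [h2] at h1
  have h3 := h1.unique ((Ad (g x₀)⁻¹ : EH →L[ℝ] EH).hasFDerivAt.comp x₀ hZ)
  convert hQ using 1
  rw [inv_mul_cancel, Ad_one, hkd] at h3
  ext v
  have h4 := congrArg (fun L : E →L[ℝ] EH => L v) h3
  simp at h4 ⊢
  rw [← h4]; abel

/-- The derivative at `k = 1` of `Ad(h k h⁻¹) Ad(h) Y = Ad(h) Ad(k) Y`. -/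
theorem Ad_bracket (h : H) (X Y : EH) : Ad h (bracket H X Y) = bracket H (Ad h X) (Ad h Y) := by
  set k := (extChartAt 𝓘(ℝ, EH) (1 : H)).symm with hk
  have hd : MDifferentiableAt 𝓘(ℝ, EH) 𝓘(ℝ, EH) k (chartOne EH H) :=
    (contMDiffAt_extChartAt_symm_self (1 : H) chartOne_mem).mdifferentiableAt (by simp)
  have hid : mder 𝓘(ℝ, EH) 𝓘(ℝ, EH) k (chartOne EH H) = .id ℝ EH :=
    mder_extChartAt_symm_self (1 : H)
  have h1 := (Ad h : EH →L[ℝ] EH).hasFDerivAt.comp _ ((hasFDerivAt_Ad_comp_one hd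
    symm_chartOne).clm_apply (hasFDerivAt_const Y (chartOne EH H)))
  have hd2 : MDifferentiableAt 𝓘(ℝ, EH) 𝓘(ℝ, EH) (fun x => h * k x * h⁻¹) (chartOne EH H) :=
    MDifferentiableAt.comp _ (mdifferentiableAt_conj h _) hd
  have h2 := (hasFDerivAt_Ad_comp_one hd2 (by rw [hk, symm_chartOne]; simp)).clm_apply
    (hasFDerivAt_const (Ad h Y) (chartOne EH H))
  have h3 : mder 𝓘(ℝ, EH) 𝓘(ℝ, EH) (fun x => h * k x * h⁻¹) (chartOne EH H) =
      (Ad h : EH →L[ℝ] EH).comp (mder 𝓘(ℝ, EH) 𝓘(ℝ, EH) k (chartOne EH H)) :=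
    mder_comp (mdifferentiableAt_conj h 1) hd symm_chartOne
  have h4 : (fun x => Ad (h * k x * h⁻¹) (Ad h Y)) = fun x => Ad h (Ad (k x) Y) := by
    funext x
    rw [Ad_mul_apply, Ad_mul_apply, Ad_inv_Ad]
  rw [h4] at h2
  have h5 := congrArg (fun L : EH →L[ℝ] EH => L X) (h1.unique h2)
  rw [h3, hid] at h5
  simpa using h5

/-- The derivative of `g⁻¹ dg (v)` along a curve `g` of maps to `H` starting at `1`. -/
theorem hasDerivAt_maurerCartan {κ : ℝ → E → H} {x₀ : E} {U : Set E} (hU : U ∈ 𝓝 x₀)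
    (hκ : ∀ τ, ∀ y ∈ U, ContMDiffAt 𝓘(ℝ, ℝ × E) 𝓘(ℝ, EH) ∞ (Function.uncurry κ) (τ, y))
    (h0 : ∀ y, κ 0 y = 1) (v : E) :
    HasDerivAt (fun τ => maurerCartan (κ τ x₀) (mder 𝓘(ℝ, E) 𝓘(ℝ, EH) (κ τ) x₀ v))
      (fderiv ℝ (fun x => mder 𝓘(ℝ, ℝ) 𝓘(ℝ, EH) (fun τ => κ τ x) 0 1) x₀ v) 0 := by
  have hx₀ : x₀ ∈ U := mem_of_mem_nhds hU
  have hs : ∀ τ, ∀ y ∈ U, MDifferentiableAt 𝓘(ℝ, E) 𝓘(ℝ, EH) (κ τ) y := fun τ y hy =>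
    ((hκ τ y hy).comp y (contDiff_prodMk_right τ).contMDiff.contMDiffAt).mdifferentiableAt (by simp)
  have ht : ∀ τ, ∀ y ∈ U, MDifferentiableAt 𝓘(ℝ, ℝ) 𝓘(ℝ, EH) (fun τ => κ τ y) τ := fun τ y hy =>
    ((hκ τ y hy).comp τ (contDiff_prodMk_left y).contMDiff.contMDiffAt).mdifferentiableAt (by simp)
  -- The map `κ(τ,x₀)⁻¹ κ(τ,y)` equals `1` at `y = x₀` for every `τ`. So a single chart at `1` reads
  -- all its `y`-derivatives there, which are the values of the Maurer-Cartan form, and symmetry of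
  -- mixed partials applies.
  have hN : ContDiffAt ℝ ∞ (Function.uncurry fun τ y =>
      extChartAt 𝓘(ℝ, EH) (1 : H) ((κ τ x₀)⁻¹ * κ τ y)) (0, x₀) := by
    rw [← contMDiffAt_iff_contDiffAt]
    have h1 : ContMDiffAt 𝓘(ℝ, ℝ × E) 𝓘(ℝ, EH) ∞ (fun q : ℝ × E => κ q.1 x₀) (0, x₀) :=
      (hκ 0 x₀ hx₀).comp (f := fun q : ℝ × E => (q.1, x₀)) (0, x₀)
        (contDiff_fst.prodMk contDiff_const).contMDiff.contMDiffAt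
    refine ContMDiffAt.comp (g := extChartAt 𝓘(ℝ, EH) (1 : H))
      (f := fun q : ℝ × E => (κ q.1 x₀)⁻¹ * κ q.1 q.2) (0, x₀)
      (contMDiffAt_extChartAt_self (1 : H) ?_) (h1.inv.mul (hκ 0 x₀ hx₀))
    simp only [inv_mul_cancel]; exact mem_extChartAt_source 1
  have h1 := hasDerivAt_fderiv_mixed hN v
  have h2 : ∀ τ, fderiv ℝ (fun y => extChartAt 𝓘(ℝ, EH) (1 : H) ((κ τ x₀)⁻¹ * κ τ y)) x₀ =
      (maurerCartan (κ τ x₀)).comp (mder 𝓘(ℝ, E) 𝓘(ℝ, EH) (κ τ) x₀) := fun τ => by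
    rw [fderiv_chart_comp (k := fun y => (κ τ x₀)⁻¹ * κ τ y) (MDifferentiableAt.comp x₀
      (mdifferentiableAt_mul_left (κ τ x₀)⁻¹ (κ τ x₀)) (hs τ x₀ hx₀)) (inv_mul_cancel _)]
    exact mder_comp (mdifferentiableAt_mul_left (κ τ x₀)⁻¹ (κ τ x₀)) (hs τ x₀ hx₀) rfl
  simp only [h2] at h1
  refine h1.congr_deriv ?_
  -- Since `κ(0,·) = 1`, the `τ`-derivative is the velocity at `y` minus the velocity at `x₀`; the
  -- latter is constant in `y` and disappears on differentiating.
  have h3 : (fun y => deriv (fun τ => extChartAt 𝓘(ℝ, EH) (1 : H) ((κ τ x₀)⁻¹ * κ τ y)) 0) =ᶠ[𝓝 x₀]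
      fun y => mder 𝓘(ℝ, ℝ) 𝓘(ℝ, EH) (fun τ => κ τ y) 0 1 -
        mder 𝓘(ℝ, ℝ) 𝓘(ℝ, EH) (fun τ => κ τ x₀) 0 1 := by
    filter_upwards [hU] with y hy
    have hk := mdifferentiableAt_inv_mul (ht 0 x₀ hx₀) (ht 0 y hy)
    rw [← fderiv_apply_one_eq_deriv, fderiv_chart_comp hk (by simp [h0]),
      mder_inv_mul_one (ht 0 x₀ hx₀) (ht 0 y hy) (h0 _) (h0 _)]
    rfl
  rw [h3.fderiv_eq, fderiv_sub_const]

end AdjointCalculus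

/-! ### Integrals with parameters and Hadamard's lemma. -/

section ParametricAnalysis

set_option linter.unusedSectionVars false

variable {E F : Type*} [NormedAddCommGroup E] [NormedSpace ℝ E] [FiniteDimensional ℝ E]
  [NormedAddCommGroup F] [NormedSpace ℝ F] [CompleteSpace F]

open MeasureTheory intervalIntegral in
theorem hasFDerivAt_integral_param {h : ℝ → E → F} {U : Set E} (hU : IsOpen U)
    (hh : ContDiffOn ℝ 1 (Function.uncurry h) (Set.univ ×ˢ U)) {x₀ : E} (hx : x₀ ∈ U) :
    HasFDerivAt (fun x => ∫ s in (0 : ℝ)..1, h s x)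
      (∫ s in (0 : ℝ)..1, fderiv ℝ (h s) x₀) x₀ := by
  have hop : IsOpen ((Set.univ : Set ℝ) ×ˢ U) := isOpen_univ.prod hU
  have hd : ∀ s, ∀ x ∈ U, HasFDerivAt (h s)
      ((fderiv ℝ (Function.uncurry h) (s, x)).comp (.inr ℝ ℝ E)) x := fun s x hx =>
    HasFDerivAt.comp (f := fun y => (s, y)) x
      (((hh.contDiffAt (hop.mem_nhds ⟨trivial, hx⟩)).differentiableAt (by simp)).hasFDerivAt)
      (hasFDerivAt_prodMk_right s x)
  have hcont : ContinuousOn (fun q : ℝ × E => fderiv ℝ (h q.1) q.2) (Set.univ ×ˢ U) := by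
    have h1 : ContinuousOn (fun q : ℝ × E =>
        (fderiv ℝ (Function.uncurry h) q).comp (.inr ℝ ℝ E)) (Set.univ ×ˢ U) :=
      (hh.continuousOn_fderiv_of_isOpen hop le_rfl).clm_comp continuousOn_const
    exact h1.congr fun q hq => (hd q.1 q.2 hq.2).fderiv
  -- Finite dimension gives a compact neighbourhood `K`; the bound of the derivative on `[0,1] × K`
  -- is the constant dominating function.
  obtain ⟨K, hK, hxK, hKU⟩ := exists_compact_subset hU hx
  obtain ⟨C, hC⟩ := ((isCompact_Icc (a := (0 : ℝ)) (b := 1)).prod hK).exists_bound_of_continuousOn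
    (hcont.mono (Set.prod_mono (Set.subset_univ _) hKU))
  have hslice : ∀ x ∈ U, Continuous (fun s => h s x) := fun x hx => by
    rw [← continuousOn_univ]
    exact hh.continuousOn.comp (Continuous.prodMk_left x).continuousOn fun s _ => ⟨trivial, hx⟩
  have hslice' : Continuous (fun s => fderiv ℝ (h s) x₀) := by
    rw [← continuousOn_univ]
    exact hcont.comp (f := fun s : ℝ => (s, x₀)) (Continuous.prodMk_left x₀).continuousOn
      fun s _ => ⟨trivial, hx⟩
  refine (hasFDerivAt_integral_of_dominated_of_fderiv_le (μ := volume) (bound := fun _ => C)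
    (F' := fun x s => fderiv ℝ (h s) x) (s := K) (mem_interior_iff_mem_nhds.1 hxK)
    ?_ ((hslice x₀ hx).intervalIntegrable _ _) hslice'.aestronglyMeasurable ?_
    (by simp) ?_)
  · filter_upwards [hU.mem_nhds hx] with x hx
    exact (hslice x hx).aestronglyMeasurable
  · refine Filter.Eventually.of_forall fun s hs x hx => hC (s, x) ⟨?_, hx⟩
    rw [Set.uIoc_of_le zero_le_one] at hs
    exact ⟨hs.1.le, hs.2⟩
  · exact Filter.Eventually.of_forall fun s _ x hx =>
      (hd s x (hKU hx)).differentiableAt.hasFDerivAt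

open MeasureTheory in
theorem contDiffOn_integral_param_nat (n : ℕ) {h : ℝ → E → F} {U : Set E} (hU : IsOpen U)
    (hh : ContDiffOn ℝ ∞ (Function.uncurry h) (Set.univ ×ˢ U)) :
    ContDiffOn ℝ n (fun x => ∫ s in (0 : ℝ)..1, h s x) U := by
  have hop : IsOpen ((Set.univ : Set ℝ) ×ˢ U) := isOpen_univ.prod hU
  induction n generalizing h with
  | zero =>
    rw [Nat.cast_zero, contDiffOn_zero]
    exact fun x hx => ((hasFDerivAt_integral_param hU (hh.of_le (by simp)) hx).continuousAt).continuousWithinAt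
  | succ n ih =>
    rw [Nat.cast_add, Nat.cast_one, contDiffOn_succ_iff_fderiv_of_isOpen hU]
    refine ⟨fun x hx => ((hasFDerivAt_integral_param hU (hh.of_le (by simp)) hx).differentiableAt).differentiableWithinAt, by simp, ?_⟩
    -- Testing on a fixed vector `v` keeps the integrand valued in `F`, so the induction hypothesis
    -- applies to the directional derivative.
    rw [contDiffOn_clm_apply]
    intro v
    have hfd : ∀ s, ∀ x ∈ U, fderiv ℝ (h s) x v = fderiv ℝ (Function.uncurry h) (s, x) (0, v) := by
      intro s x hx
      have := HasFDerivAt.comp (f := fun y => (s, y)) x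
        (((hh.contDiffAt (hop.mem_nhds ⟨trivial, hx⟩)).differentiableAt (by simp)).hasFDerivAt)
        (hasFDerivAt_prodMk_right s x)
      exact congrArg (fun L : E →L[ℝ] F => L v) this.fderiv
    have h1 : ContDiffOn ℝ ∞ (Function.uncurry fun (s : ℝ) (x : E) => fderiv ℝ (h s) x v)
        (Set.univ ×ˢ U) :=
      ((hh.fderiv_of_isOpen hop (by simp)).clm_apply contDiffOn_const).congr
        fun q hq => hfd q.1 q.2 hq.2
    refine (ih h1).congr fun x hx => ?_
    rw [(hasFDerivAt_integral_param hU (hh.of_le (by simp)) hx).fderiv]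
    refine ContinuousLinearMap.intervalIntegral_apply ?_ v
    have hcont : ContinuousOn (fun q : ℝ × E =>
        (fderiv ℝ (Function.uncurry h) q).comp (.inr ℝ ℝ E)) (Set.univ ×ˢ U) :=
      (hh.continuousOn_fderiv_of_isOpen hop (by simp)).clm_comp continuousOn_const
    have h2 : Continuous (fun s => fderiv ℝ (h s) x) := by
      rw [← continuousOn_univ]
      refine (hcont.comp (f := fun s : ℝ => (s, x)) (Continuous.prodMk_left x).continuousOn
        fun s _ => ⟨trivial, hx⟩).congr fun s _ => ?_
      have := HasFDerivAt.comp (f := fun y => (s, y)) x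
        (((hh.contDiffAt (hop.mem_nhds ⟨trivial, hx⟩)).differentiableAt (by simp)).hasFDerivAt)
        (hasFDerivAt_prodMk_right s x)
      exact this.fderiv
    exact h2.intervalIntegrable _ _

theorem contDiffOn_integral_param {h : ℝ → E → F} {U : Set E} (hU : IsOpen U)
    (hh : ContDiffOn ℝ ∞ (Function.uncurry h) (Set.univ ×ˢ U)) :
    ContDiffOn ℝ ∞ (fun x => ∫ s in (0 : ℝ)..1, h s x) U :=
  contDiffOn_infty.2 fun n => contDiffOn_integral_param_nat n hU hh

/-- The fundamental theorem of calculus on the segment from `0` to `t`, rescaled to `[0,1]`. The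
choice of `dslope` makes it hold at `t = 0` too, where both sides are the derivative. -/
theorem dslope_zero_eq_integral {f : ℝ → F} (hf : ContDiff ℝ 1 f) (t : ℝ) :
    dslope f 0 t = ∫ s in (0 : ℝ)..1, deriv f (s * t) := by
  rcases eq_or_ne t 0 with rfl | ht
  · simp
  · rw [dslope_of_ne _ ht, slope_def_module, sub_zero,
      intervalIntegral.integral_comp_mul_right (fun s => deriv f s) ht, zero_mul, one_mul,
      intervalIntegral.integral_deriv_eq_sub (fun x _ => (hf.differentiable (by simp)) x)
        ((hf.continuous_deriv le_rfl).intervalIntegrable _ _)]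

/-- Hadamard's lemma with parameters, in a vector space. -/
theorem contDiffOn_dslope_zero {f : ℝ → E → F} {U : Set E} (hU : IsOpen U)
    (hf : ContDiffOn ℝ ∞ (Function.uncurry f) (Set.univ ×ˢ U)) :
    ContDiffOn ℝ ∞ (fun q : ℝ × E => dslope (fun τ => f τ q.2) 0 q.1) (Set.univ ×ˢ U) := by
  have hop : IsOpen ((Set.univ : Set ℝ) ×ˢ U) := isOpen_univ.prod hU
  have hsl : ∀ x ∈ U, ContDiff ℝ ∞ (fun τ => f τ x) := fun x hx => by
    rw [← contDiffOn_univ]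
    exact hf.comp (f := fun τ : ℝ => (τ, x)) (contDiff_prodMk_left x).contDiffOn
      fun s _ => ⟨trivial, hx⟩
  have hd : ∀ τ, ∀ x ∈ U, deriv (fun τ => f τ x) τ =
      fderiv ℝ (Function.uncurry f) (τ, x) (1, 0) := fun τ x hx => by
    have := HasFDerivAt.comp (f := fun τ => (τ, x)) τ
      (((hf.contDiffAt (hop.mem_nhds ⟨trivial, hx⟩)).differentiableAt (by simp)).hasFDerivAt)
      (hasFDerivAt_prodMk_left τ x)
    exact this.hasDerivAt.deriv
  have h1 : ContDiffOn ℝ ∞ (Function.uncurry fun (s : ℝ) (q : ℝ × E) =>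
      fderiv ℝ (Function.uncurry f) (s * q.1, q.2) (1, 0)) (Set.univ ×ˢ (Set.univ ×ˢ U)) := by
    refine ContDiffOn.clm_apply (ContDiffOn.comp (g := fderiv ℝ (Function.uncurry f))
      (f := fun q : ℝ × (ℝ × E) => (q.1 * q.2.1, q.2.2)) (t := Set.univ ×ˢ U)
      (hf.fderiv_of_isOpen hop (by simp)) ?_ fun q hq => ⟨trivial, hq.2.2⟩) contDiffOn_const
    exact ContDiff.contDiffOn (by fun_prop)
  refine (contDiffOn_integral_param hop h1).congr fun q hq => ?_
  rw [dslope_zero_eq_integral ((hsl q.2 hq.2).of_le (by simp))]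
  simp only [hd _ q.2 hq.2]

variable {K N : Type*} [TopologicalSpace K] {I : ModelWithCorners ℝ E K} [I.Boundaryless]
  [TopologicalSpace N] [ChartedSpace K N] [IsManifold I ∞ N]

/-- Hadamard's lemma with parameters in a manifold. -/
theorem contMDiff_dslope_zero {f : ℝ → N → F}
    (hf : ContMDiff (𝓘(ℝ, ℝ).prod I) 𝓘(ℝ, F) ∞ (Function.uncurry f)) :
    ContMDiff (𝓘(ℝ, ℝ).prod I) 𝓘(ℝ, F) ∞
      (fun q : ℝ × N => dslope (fun τ => f τ q.2) 0 q.1) := by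
  rintro ⟨t, x₀⟩
  set φ := extChartAt I x₀ with hφ
  have hU : IsOpen φ.target := isOpen_extChartAt_target x₀
  have h1 : ContDiffOn ℝ ∞ (Function.uncurry fun (τ : ℝ) (y : E) => f τ (φ.symm y))
      (Set.univ ×ˢ φ.target) := by
    rw [← contMDiffOn_iff_contDiffOn]
    refine hf.comp_contMDiffOn (f := fun q : ℝ × E => (q.1, φ.symm q.2))
      (contDiff_fst.contMDiff.contMDiffOn.prodMk ?_)
    exact (contMDiffOn_extChartAt_symm x₀).comp contDiff_snd.contMDiff.contMDiffOn fun q hq => hq.2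
  have h2 := contDiffOn_dslope_zero hU h1
  have hx₀ : x₀ ∈ φ.source := mem_extChartAt_source x₀
  have h3 : ContMDiffAt (𝓘(ℝ, ℝ).prod I) 𝓘(ℝ, ℝ × E) ∞ (fun q : ℝ × N => (q.1, φ q.2)) (t, x₀) := by
    have ha : ContMDiffAt (𝓘(ℝ, ℝ).prod I) 𝓘(ℝ, ℝ) ∞ (fun q : ℝ × N => q.1) (t, x₀) :=
      contMDiffAt_fst
    have hb : ContMDiffAt (𝓘(ℝ, ℝ).prod I) 𝓘(ℝ, E) ∞ (fun q : ℝ × N => φ q.2) (t, x₀) :=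
      ContMDiffAt.comp (g := φ) (t, x₀) contMDiffAt_extChartAt contMDiffAt_snd
    exact ha.prodMk_space hb
  have h4 : ContDiffAt ℝ ∞ (fun q : ℝ × E => dslope (fun τ => f τ (φ.symm q.2)) 0 q.1) (t, φ x₀) :=
    h2.contDiffAt ((isOpen_univ.prod hU).mem_nhds ⟨trivial, φ.map_source hx₀⟩)
  refine (ContMDiffAt.comp (t, x₀) (contMDiffAt_iff_contDiffAt.2 h4) h3).congr_of_eventuallyEq ?_
  have h5 : ∀ᶠ q : ℝ × N in 𝓝 (t, x₀), q.2 ∈ φ.source :=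
    (continuous_snd.tendsto (t, x₀)).eventually (extChartAt_source_mem_nhds x₀)
  filter_upwards [h5] with q hq
  simp only [Function.comp_def]
  rw [φ.left_inv hq]

end ParametricAnalysis

/-! ### Smooth dependence of a time derivative on a parameter in a manifold. -/

section ParametricDerivative

variable {E F : Type*} [NormedAddCommGroup E] [NormedSpace ℝ E]
  [NormedAddCommGroup F] [NormedSpace ℝ F]
  {K N : Type*} [TopologicalSpace K] {I : ModelWithCorners ℝ E K}
  [TopologicalSpace N] [ChartedSpace K N] [IsManifold I ∞ N]

theorem contMDiffAt_deriv_zero {f : ℝ → N → F} {x₀ : N}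
    (hf : ContMDiffAt (𝓘(ℝ, ℝ).prod I) 𝓘(ℝ, F) ∞ (Function.uncurry f) (0, x₀)) :
    ContMDiffAt I 𝓘(ℝ, F) ∞ (fun x => deriv (fun τ => f τ x) 0) x₀ := by
  have hs : ContMDiffAt (I.prod 𝓘(ℝ, ℝ)) 𝓘(ℝ, F) ∞
      (Function.uncurry fun (x : N) (τ : ℝ) => f τ x) (x₀, 0) :=
    ContMDiffAt.comp (f := fun q : N × ℝ => (q.2, q.1)) (x₀, 0) hf
      (contMDiffAt_snd.prodMk contMDiffAt_fst)
  have h1 := ContMDiffAt.mfderiv (m := ∞) (n := ∞) (fun (x : N) (τ : ℝ) => f τ x) (fun _ => (0 : ℝ))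
    hs contMDiffAt_const (by simp)
  have h2 : ContMDiffAt I 𝓘(ℝ, ℝ →L[ℝ] F) ∞
      (inTangentCoordinates 𝓘(ℝ, ℝ) 𝓘(ℝ, F) (fun _ : N => (0 : ℝ)) (fun x => f 0 x)
        (fun x => mder 𝓘(ℝ, ℝ) 𝓘(ℝ, F) (fun τ => f τ x) 0) x₀) x₀ := h1
  rw [inTangentCoordinates_model_space] at h2
  simp only [mder_eq_fderiv] at h2
  exact h2.clm_apply contMDiffAt_const

end ParametricDerivative

end GaugeBundle
end

open scoped Manifold ContDiff Topology

noncomputable section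

namespace GaugeBundle

set_option linter.unusedSectionVars false

variable {EM EP EH : Type*} [NormedAddCommGroup EM] [NormedSpace ℝ EM]
  [NormedAddCommGroup EP] [NormedSpace ℝ EP] [NormedAddCommGroup EH] [NormedSpace ℝ EH]
  {M P H : Type*} [TopologicalSpace M] [ChartedSpace EM M] [TopologicalSpace P]
  [ChartedSpace EP P] [TopologicalSpace H] [ChartedSpace EH H] [Group H]
  [IsManifold 𝓘(ℝ, EP) ∞ P] {B : PrincipalBundle EM EP EH M P H}

/-! ### The pointwise formula for the gauge action on forms. -/

section GaugeAction

/-- The tangent vector `v` at `p`. -/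
def tvec (p : P) (v : EP) : TangentBundle 𝓘(ℝ, EP) P := ⟨p, v⟩

theorem tangentMap_tvec {N : Type*} [TopologicalSpace N] [ChartedSpace EP N] (f : P → N) (p : P)
    (v : EP) : tangentMap 𝓘(ℝ, EP) 𝓘(ℝ, EP) f (tvec p v) =
      tvec (f p) (mder 𝓘(ℝ, EP) 𝓘(ℝ, EP) f p v) := rfl

theorem vert_eq_tvec (X : EH) (p : P) :
    B.vert X p = tvec p (mder 𝓘(ℝ, EH) 𝓘(ℝ, EP) (B.act p) 1 X) :=
  congrArg (fun q => tvec q (mder 𝓘(ℝ, EH) 𝓘(ℝ, EP) (B.act p) 1 X)) (B.act_one p)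

theorem IsOneForm.tvec_add {α : TangentBundle 𝓘(ℝ, EP) P → EH} (hα : IsOneForm α) (p : P)
    (u v : EP) : α (tvec p (u + v)) = α (tvec p u) + α (tvec p v) := hα.map_add p u v

theorem mdifferentiableAt_act (p : P) (h : H) :
    MDifferentiableAt (𝓘(ℝ, EP).prod 𝓘(ℝ, EH)) 𝓘(ℝ, EP) (fun q : P × H => B.act q.1 q.2) (p, h) :=
  B.contMDiff_act.mdifferentiable (by simp) _

theorem Gauge.mdifferentiableAt (g : Gauge B) (p : P) :
    MDifferentiableAt 𝓘(ℝ, EP) 𝓘(ℝ, EH) g p := g.smooth.mdifferentiable (by simp) p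

theorem Connection.ext' {A A' : Connection B} (h : ∀ v, A v = A' v) : A = A' := by
  cases A; cases A'
  congr
  exact funext h

theorem Tensorial.ext' {A A' : Tensorial B} (h : ∀ v, A v = A' v) : A = A' := by
  cases A; cases A'
  congr
  exact funext h

variable [LieGroup 𝓘(ℝ, EH) ∞ H]

theorem mder_act_left (p : P) (h : H) (u : EH) :
    mder 𝓘(ℝ, EH) 𝓘(ℝ, EP) (B.act p) h u =
      mder 𝓘(ℝ, EH) 𝓘(ℝ, EP) (B.act (B.act p h)) 1 (maurerCartan h u) := by
  have h1 := mder_comp_apply (g := B.act (B.act p h)) (f := fun k : H => h⁻¹ * k) (x := h) (y := 1)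
    ((B.contMDiff_act_left (B.act p h)).mdifferentiable (by simp) 1)
    (mdifferentiableAt_mul_left h⁻¹ h) (inv_mul_cancel h) u
  rw [maurerCartan, ← h1]
  simp only [← B.act_mul, mul_inv_cancel_left]

/-- The product rule for `q ↦ q g(q)`: varying the point gives a right translation, and varying the
group element gives a vertical vector, made vertical at `p g(p)` by left translation to the
identity. -/
theorem mder_gauge_map (g : Gauge B) (p : P) (w : EP) :
    mder 𝓘(ℝ, EP) 𝓘(ℝ, EP) g.map p w =
      mder 𝓘(ℝ, EP) 𝓘(ℝ, EP) (fun q => B.act q (g p)) p w +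
      mder 𝓘(ℝ, EH) 𝓘(ℝ, EP) (B.act (g.map p)) 1
        (maurerCartan (g p) (mder 𝓘(ℝ, EP) 𝓘(ℝ, EH) g p w)) := by
  have h1 := mder_comp_apply (g := fun q : P × H => B.act q.1 q.2) (f := fun q => (q, g q)) (x := p)
    (mdifferentiableAt_act p (g p)) (mdifferentiableAt_id.prodMk (g.mdifferentiableAt p)) rfl w
  rw [mder_prodMk (f := fun q : P => q) mdifferentiableAt_id (g.mdifferentiableAt p), mder_prod_add
    (mdifferentiableAt_act p (g p))] at h1
  refine h1.trans ?_
  rw [mder_id, mder_act_left]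
  rfl

/-- Common to connections and tensorial forms, which differ only in their values on vertical
vectors: the last term becomes `g⁻¹dg` for the former and vanishes for the latter. -/
theorem IsOneForm.apply_tangentMap_map {α : TangentBundle 𝓘(ℝ, EP) P → EH} (hα : IsOneForm α)
    (heq : ∀ (h : H) (v : TangentBundle 𝓘(ℝ, EP) P), α (B.rightPush h v) = Ad h⁻¹ (α v))
    (g : Gauge B) (p : P) (w : EP) :
    α (tangentMap 𝓘(ℝ, EP) 𝓘(ℝ, EP) g.map (tvec p w)) = Ad (g p)⁻¹ (α (tvec p w)) +
      α (B.vert (maurerCartan (g p) (mder 𝓘(ℝ, EP) 𝓘(ℝ, EH) g p w)) (g.map p)) := by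
  rw [tangentMap_tvec, mder_gauge_map, hα.tvec_add, ← heq, vert_eq_tvec]
  rfl

theorem Connection.gauge_tvec (A : Connection B) (g : Gauge B) (p : P) (w : EP) :
    A.gauge g (tvec p w) = Ad (g p)⁻¹ (A (tvec p w)) +
      maurerCartan (g p) (mder 𝓘(ℝ, EP) 𝓘(ℝ, EH) g p w) := by
  refine (A.isOneForm.apply_tangentMap_map A.equivariant g p w).trans ?_
  rw [A.map_vert]

theorem Tensorial.apply_tangentMap_map (Z : Tensorial B) (g : Gauge B) (p : P) (w : EP) :
    Z (tangentMap 𝓘(ℝ, EP) 𝓘(ℝ, EP) g.map (tvec p w)) = Ad (g p)⁻¹ (Z (tvec p w)) := by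
  rw [Z.isOneForm.apply_tangentMap_map Z.equivariant g p w, Z.map_vert, add_zero]

/-- Equivariance gives `g(p k(p)) = k(p)⁻¹ g(p) k(p)`, so the inner factor `k(p)` cancels. Pullback
reverses composition, which makes the action on connections a right action. -/
theorem Gauge.map_mul (g k : Gauge B) : (g * k).map = g.map ∘ k.map := by
  funext p
  show B.act p (g p * k p) = B.act (B.act p (k p)) (g (B.act p (k p)))
  rw [g.equivariant, ← B.act_mul]
  group

theorem Gauge.map_one : (1 : Gauge B).map = id := funext fun p => B.act_one p

theorem Connection.gauge_mul (A : Connection B) (g k : Gauge B) :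
    A.gauge (g * k) = (A.gauge g).gauge k := by
  refine Connection.ext' fun v => ?_
  show A (tangentMap _ _ (g * k).map v) = A (tangentMap _ _ g.map (tangentMap _ _ k.map v))
  rw [Gauge.map_mul, tangentMap_comp_at v (g.contMDiff_map.mdifferentiable (by simp) _)
    (k.contMDiff_map.mdifferentiable (by simp) _)]

theorem Connection.gauge_one (A : Connection B) : A.gauge 1 = A := by
  refine Connection.ext' fun v => ?_
  show A (tangentMap _ _ (1 : Gauge B).map v) = A v
  rw [Gauge.map_one, tangentMap_id]
  rfl

end GaugeAction

/-! ### Smooth families under reparametrization, gauge action and field-dependent maps. -/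

section Families

variable {F F' : Type*} [NormedAddCommGroup F] [NormedSpace ℝ F]
  [NormedAddCommGroup F'] [NormedSpace ℝ F']

theorem SmoothFamily.comp {c : F → Connection B} (hc : SmoothFamily c) {f : F' → F}
    (hf : ContDiff ℝ ∞ f) : SmoothFamily (fun s => c (f s)) :=
  ContMDiff.comp (f := fun q : F' × TangentBundle 𝓘(ℝ, EP) P => (f q.1, q.2)) hc
    ((hf.contMDiff.comp contMDiff_fst).prodMk contMDiff_snd)

theorem SmoothGaugeFamily.comp {g : F → Gauge B} (hg : SmoothGaugeFamily g) {f : F' → F}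
    (hf : ContDiff ℝ ∞ f) : SmoothGaugeFamily (fun s => g (f s)) :=
  ContMDiff.comp (f := fun q : F' × P => (f q.1, q.2)) hg
    ((hf.contMDiff.comp contMDiff_fst).prodMk contMDiff_snd)

theorem smoothFamily_const (A : Connection B) : SmoothFamily (fun _ : F => A) :=
  A.isOneForm.smooth.comp contMDiff_snd

theorem smoothGaugeFamily_const (g : Gauge B) : SmoothGaugeFamily (fun _ : F => g) :=
  g.smooth.comp contMDiff_snd

theorem SmoothFamily.slice {c : F → Connection B} (hc : SmoothFamily c)
    (v : TangentBundle 𝓘(ℝ, EP) P) : ContDiff ℝ ∞ (fun s => c s v) := by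
  rw [← contMDiff_iff_contDiff]
  exact ContMDiff.comp (f := fun s : F => (s, v)) hc (contMDiff_id.prodMk contMDiff_const)

theorem SmoothGaugeFamily.slice {g : F → Gauge B} (hg : SmoothGaugeFamily g) (p : P) :
    ContMDiff 𝓘(ℝ, F) 𝓘(ℝ, EH) ∞ (fun s => g s p) :=
  ContMDiff.comp (f := fun s : F => (s, p)) hg (contMDiff_id.prodMk contMDiff_const)

theorem SmoothGaugeFamily.mdifferentiableAt {g : F → Gauge B} (hg : SmoothGaugeFamily g) (p : P)
    (s : F) : MDifferentiableAt 𝓘(ℝ, F) 𝓘(ℝ, EH) (fun s => g s p) s :=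
  (hg.slice p).mdifferentiable (by simp) s

/-- The family `(s, v) ↦ d(f_s)(v)` of a smooth family of maps is smooth. -/
theorem contMDiff_tangentMap_family {N EN : Type*} [NormedAddCommGroup EN] [NormedSpace ℝ EN]
    [TopologicalSpace N] [ChartedSpace EN N] [IsManifold 𝓘(ℝ, EN) ∞ N] {f : F → P → N}
    (hf : ContMDiff (𝓘(ℝ, F).prod 𝓘(ℝ, EP)) 𝓘(ℝ, EN) ∞ (Function.uncurry f)) :
    ContMDiff (𝓘(ℝ, F).prod 𝓘(ℝ, EP).tangent) 𝓘(ℝ, EN).tangent ∞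
      (fun q : F × TangentBundle 𝓘(ℝ, EP) P => tangentMap 𝓘(ℝ, EP) 𝓘(ℝ, EN) (f q.1) q.2) := by
  have : IsManifold 𝓘(ℝ, EP) 1 P := IsManifold.of_le (n := ∞) (by simp)
  have : IsManifold 𝓘(ℝ, EN) 1 N := IsManifold.of_le (n := ∞) (by simp)
  have h1 := hf.contMDiff_tangentMap (m := ∞) (by simp)
  -- The derivative of the slice `f_s` is the derivative of the joint map on vectors with zero
  -- component along the parameters, so the zero section is inserted in that factor.
  have h2 : ContMDiff (𝓘(ℝ, F).prod 𝓘(ℝ, EP).tangent) (𝓘(ℝ, F).tangent.prod 𝓘(ℝ, EP).tangent) ∞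
      (fun q : F × TangentBundle 𝓘(ℝ, EP) P =>
        ((Bundle.zeroSection F (TangentSpace 𝓘(ℝ, F)) q.1 : TangentBundle 𝓘(ℝ, F) F), q.2)) :=
    ((Bundle.contMDiff_zeroSection ℝ _).comp contMDiff_fst).prodMk contMDiff_snd
  have h3 := (h1.comp contMDiff_equivTangentBundleProd_symm).comp h2
  refine h3.congr fun q => ?_
  obtain ⟨s, p, w⟩ := q
  have h4 := mder_prod_add (f := Function.uncurry f) (x := s) (y := p)
    (hf.mdifferentiable (by simp) (s, p)) 0 w
  rw [map_zero, zero_add] at h4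
  exact congrArg (fun u : EN => (⟨f s p, u⟩ : TangentBundle 𝓘(ℝ, EN) N)) h4.symm

theorem SmoothFamily.gauge {c : F → Connection B} (hc : SmoothFamily c) {g : F → Gauge B}
    (hg : SmoothGaugeFamily g) : SmoothFamily (fun s => (c s).gauge (g s)) := by
  have h1 : ContMDiff (𝓘(ℝ, F).prod 𝓘(ℝ, EP)) 𝓘(ℝ, EP) ∞ (Function.uncurry fun s => (g s).map) :=
    B.contMDiff_act.comp (contMDiff_snd.prodMk hg)
  exact ContMDiff.comp (f := fun q : F × TangentBundle 𝓘(ℝ, EP) P =>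
    (q.1, tangentMap 𝓘(ℝ, EP) 𝓘(ℝ, EP) (g q.1).map q.2)) hc
    (contMDiff_fst.prodMk (contMDiff_tangentMap_family h1))

theorem SmoothGaugeFamily.mul [LieGroup 𝓘(ℝ, EH) ∞ H] {g k : F → Gauge B}
    (hg : SmoothGaugeFamily g) (hk : SmoothGaugeFamily k) :
    SmoothGaugeFamily (fun s => g s * k s) := ContMDiff.mul hg hk

/-- A linear isomorphism with a Euclidean space transports smoothness to any finite-dimensional
parameter space; `ℝ` and `ℝ × ℝ` are the cases needed. -/
theorem FieldGauge.smoothGaugeFamily [LieGroup 𝓘(ℝ, EH) ∞ H] [FiniteDimensional ℝ F]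
    (γ : FieldGauge B) {c : F → Connection B} (hc : SmoothFamily c) :
    SmoothGaugeFamily (fun s => γ (c s)) := by
  have h1 := γ.smooth _ _ (hc.comp (toEuclidean (E := F)).symm.contDiff)
  have h2 := h1.comp (toEuclidean (E := F)).contDiff
  simpa using h2

theorem IsVerticalAutomorphism.smoothFamily [FiniteDimensional ℝ F]
    {Ψ : Connection B → Connection B} (hΨ : IsVerticalAutomorphism Ψ)
    {c : F → Connection B} (hc : SmoothFamily c) : SmoothFamily (fun s => Ψ (c s)) := by
  have h1 := hΨ.smooth _ _ (hc.comp (toEuclidean (E := F)).symm.contDiff)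
  have h2 := h1.comp (toEuclidean (E := F)).contDiff
  simpa using h2

end Families

/-! ### Velocities of curves and the fundamental vector fields. -/

section Velocity

theorem SmoothFamily.hasDerivAt {c : ℝ → Connection B} (hc : SmoothFamily c)
    (v : TangentBundle 𝓘(ℝ, EP) P) (t : ℝ) :
    HasDerivAt (fun τ => c τ v) (deriv (fun τ => c τ v) t) t :=
  ((hc.slice v).differentiable (by simp) t).hasDerivAt

/-- The velocity at `0` of a smooth curve of connections. -/
def SmoothFamily.velocity {c : ℝ → Connection B} (hc : SmoothFamily c) : Tensorial B where
  toFun v := deriv (fun τ => c τ v) 0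
  isOneForm :=
    { smooth := fun v => contMDiffAt_deriv_zero (f := fun τ v => c τ v) (hc (0, v))
      map_add := fun p u v => by
        have h := (hc.hasDerivAt (tvec p u) 0).add (hc.hasDerivAt (tvec p v) 0)
        refine HasDerivAt.deriv (h.congr_of_eventuallyEq (Filter.Eventually.of_forall fun τ => ?_))
        exact (c τ).isOneForm.map_add p u v
      map_smul := fun p a v => by
        have h := (hc.hasDerivAt (tvec p v) 0).const_smul a
        refine HasDerivAt.deriv (h.congr_of_eventuallyEq (Filter.Eventually.of_forall fun τ => ?_))
        exact (c τ).isOneForm.map_smul p a v }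
  equivariant h v := by
    have h1 := (Ad h⁻¹ : EH →L[ℝ] EH).hasFDerivAt.comp_hasDerivAt (0 : ℝ) (hc.hasDerivAt v 0)
    refine HasDerivAt.deriv (h1.congr_of_eventuallyEq (Filter.Eventually.of_forall fun τ => ?_))
    exact (c τ).equivariant h v
  map_vert X p := by
    simp only [(c _).map_vert, deriv_const]

variable [LieGroup 𝓘(ℝ, EH) ∞ H]

theorem Ad_eq_mder (h : H) : (Ad h : EH →L[ℝ] EH) =
    mder 𝓘(ℝ, EH) 𝓘(ℝ, EH) (fun k : H => h * k * h⁻¹) 1 := rfl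

theorem IsGaugeCurve.mder_eq {g : ℝ → Gauge B} {χ : LieGauge B} (hg : IsGaugeCurve g χ) (p : P) :
    mder 𝓘(ℝ, ℝ) 𝓘(ℝ, EH) (fun τ => g τ p) 0 1 = χ p := (hg.2.2 p).2

theorem IsGaugeCurve.of_mder {g : ℝ → Gauge B} {χ : LieGauge B} (hg : SmoothGaugeFamily g)
    (h0 : g 0 = 1) (h : ∀ p, mder 𝓘(ℝ, ℝ) 𝓘(ℝ, EH) (fun τ => g τ p) 0 1 = χ p) :
    IsGaugeCurve g χ := ⟨hg, h0, fun p => ⟨hg.mdifferentiableAt p 0, h p⟩⟩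

theorem Gauge.apply_of_eq_one {g : Gauge B} (h : g = 1) (p : P) : g p = 1 := by rw [h]; rfl

/-- The velocity at `0` of a smooth curve in the gauge group through `1`. -/
def SmoothGaugeFamily.velocity {g : ℝ → Gauge B} (hg : SmoothGaugeFamily g) (h0 : g 0 = 1) :
    LieGauge B where
  toFun p := mder 𝓘(ℝ, ℝ) 𝓘(ℝ, EH) (fun τ => g τ p) 0 1
  smooth := fun p => by
    -- All curves `τ ↦ g τ q` pass through `1` at time `0`, so one chart of the group turns their
    -- velocities into derivatives of vector-valued functions.
    have h1 : ContMDiffAt (𝓘(ℝ, ℝ).prod 𝓘(ℝ, EP)) 𝓘(ℝ, EH) ∞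
        (Function.uncurry fun τ p => extChartAt 𝓘(ℝ, EH) (1 : H) (g τ p)) (0, p) := by
      refine ContMDiffAt.comp (g := extChartAt 𝓘(ℝ, EH) (1 : H)) (0, p)
        (contMDiffAt_extChartAt_self (1 : H) ?_) (hg (0, p))
      rw [Gauge.apply_of_eq_one h0]
      exact mem_extChartAt_source 1
    refine (contMDiffAt_deriv_zero h1).congr_of_eventuallyEq (Filter.Eventually.of_forall fun q => ?_)
    show mder 𝓘(ℝ, ℝ) 𝓘(ℝ, EH) (fun τ => g τ q) 0 1 =
      deriv (fun τ => extChartAt 𝓘(ℝ, EH) (1 : H) (g τ q)) 0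
    rw [← fderiv_chart_comp (hg.mdifferentiableAt q 0) (Gauge.apply_of_eq_one h0 q),
      fderiv_apply_one_eq_deriv]
  equivariant p h := by
    simp only [(g _).equivariant]
    have h1 := mder_comp_apply (f := fun τ => g τ p) (x := (0 : ℝ)) (mdifferentiableAt_conj h⁻¹ (1 : H))
      (hg.mdifferentiableAt p 0) (Gauge.apply_of_eq_one h0 p) 1
    simp only [inv_inv] at h1
    rw [h1, Ad_eq_mder]
    simp only [inv_inv]

theorem Gauge.contMDiffAt_chart {g : ℝ → Gauge B} (hg : SmoothGaugeFamily g) (p : P) (τ : ℝ) {y : EP}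
    (hy : y ∈ (extChartAt 𝓘(ℝ, EP) p).target) :
    ContMDiffAt 𝓘(ℝ, ℝ × EP) 𝓘(ℝ, EH) ∞
      (Function.uncurry fun τ y => g τ ((extChartAt 𝓘(ℝ, EP) p).symm y)) (τ, y) := by
  refine ContMDiffAt.comp (f := fun q : ℝ × EP => (q.1, (extChartAt 𝓘(ℝ, EP) p).symm q.2)) (τ, y)
    (hg _) (contDiff_fst.contMDiff.contMDiffAt.prodMk ?_)
  exact ContMDiffAt.comp (g := (extChartAt 𝓘(ℝ, EP) p).symm) (τ, y)
    (contMDiffAt_extChartAt_symm_self p hy) contDiff_snd.contMDiff.contMDiffAt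

theorem mder_comp_chart_symm {EN N : Type*} [NormedAddCommGroup EN] [NormedSpace ℝ EN]
    [TopologicalSpace N] [ChartedSpace EN N] {f : P → N} (p : P)
    (hf : MDifferentiableAt 𝓘(ℝ, EP) 𝓘(ℝ, EN) f p) :
    mder 𝓘(ℝ, EP) 𝓘(ℝ, EN) (fun y => f ((extChartAt 𝓘(ℝ, EP) p).symm y))
      (extChartAt 𝓘(ℝ, EP) p p) = mder 𝓘(ℝ, EP) 𝓘(ℝ, EN) f p := by
  rw [mder_comp hf ((contMDiffAt_extChartAt_symm_self p
    (mem_extChartAt_target p)).mdifferentiableAt (by simp)) (extChartAt_to_inv p),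
    mder_extChartAt_symm_self, ContinuousLinearMap.comp_id]

variable [FiniteDimensional ℝ EH]

theorem covDeriv_tvec (A : Connection B) (χ : LieGauge B) (p : P) (w : EP) :
    covDeriv A χ (tvec p w) =
      mder 𝓘(ℝ, EP) 𝓘(ℝ, EH) χ p w + bracket H (A (tvec p w)) (χ p) := rfl

/-- In `A^g = Ad(g⁻¹)A + g⁻¹dg` the first term has derivative `-[χ, A] = [A, χ]` and the second
`dχ`. -/
theorem IsGaugeCurve.hasDerivAt_gauge_tvec {g : ℝ → Gauge B} {χ : LieGauge B}
    (hg : IsGaugeCurve g χ) (A : Connection B) (p : P) (w : EP) :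
    HasDerivAt (fun τ => A.gauge (g τ) (tvec p w)) (covDeriv A χ (tvec p w)) 0 := by
  have : CompleteSpace EH := FiniteDimensional.complete ℝ EH
  simp only [Connection.gauge_tvec, covDeriv_tvec]
  have h1 := (hasFDerivAt_Ad_inv (hg.1.mdifferentiableAt p 0)
    (hasFDerivAt_const (A (tvec p w)) (0 : ℝ))).hasDerivAt
  have h2 := hasDerivAt_maurerCartan
    (κ := fun τ y => g τ ((extChartAt 𝓘(ℝ, EP) p).symm y)) (x₀ := extChartAt 𝓘(ℝ, EP) p p)
    (extChartAt_target_mem_nhds_self p (mem_extChartAt_target p))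
    (fun τ y hy => Gauge.contMDiffAt_chart hg.1 p τ hy)
    (fun y => Gauge.apply_of_eq_one hg.2.1 _) w
  simp only [mder_comp_chart_symm p ((g _).mdifferentiableAt p), extChartAt_to_inv,
    hg.mder_eq, ← mder_eq_fderiv (F' := EH)] at h2
  rw [mder_comp_chart_symm p (χ.smooth.mdifferentiable (by simp) p)] at h2
  have h3 := h1.add h2
  refine h3.congr_deriv ?_
  rw [Gauge.apply_of_eq_one hg.2.1, inv_one, Ad_one, maurerCartan_one]
  simp [hg.mder_eq]
  rw [bracket_skew (χ p)]
  abel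

/-- The fundamental vector field of the action of the gauge group is the covariant derivative. -/
theorem IsGaugeCurve.hasDerivAt_gauge {g : ℝ → Gauge B} {χ : LieGauge B} (hg : IsGaugeCurve g χ)
    (A : Connection B) (v : TangentBundle 𝓘(ℝ, EP) P) :
    HasDerivAt (fun τ => A.gauge (g τ) v) (covDeriv A χ v) 0 :=
  hg.hasDerivAt_gauge_tvec A v.1 v.2

theorem hasDerivAt_diag {F : Type*} [NormedAddCommGroup F] [NormedSpace ℝ F] {f : ℝ × ℝ → F}
    (hf : DifferentiableAt ℝ f (0, 0)) {a b : F} (ha : HasDerivAt (fun s => f (s, 0)) a 0)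
    (hb : HasDerivAt (fun t => f (0, t)) b 0) : HasDerivAt (fun τ => f (τ, τ)) (a + b) 0 := by
  have h1 := HasFDerivAt.comp_hasDerivAt (f := fun s : ℝ => (s, (0 : ℝ))) 0 hf.hasFDerivAt
    ((hasDerivAt_id 0).prodMk (hasDerivAt_const 0 0))
  have h2 := HasFDerivAt.comp_hasDerivAt (f := fun s : ℝ => ((0 : ℝ), s)) 0 hf.hasFDerivAt
    ((hasDerivAt_const 0 0).prodMk (hasDerivAt_id 0))
  have h3 := HasFDerivAt.comp_hasDerivAt (f := fun s : ℝ => (s, s)) 0 hf.hasFDerivAt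
    ((hasDerivAt_id 0).prodMk (hasDerivAt_id 0))
  refine h3.congr_deriv ?_
  rw [ha.unique h1, hb.unique h2, ← map_add]
  simp

/-- The velocity of `c^g` for curves `c` of connections and `g` in the gauge group. -/
theorem IsCurveAt.hasDerivAt_gauge {c : ℝ → Connection B} {A : Connection B} {X : Tensorial B}
    (hc : IsCurveAt c A X) {g : ℝ → Gauge B} {χ : LieGauge B} (hg : IsGaugeCurve g χ)
    (v : TangentBundle 𝓘(ℝ, EP) P) :
    HasDerivAt (fun τ => (c τ).gauge (g τ) v) (X v + covDeriv A χ v) 0 := by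
  -- Separating the two times makes the velocity a sum of partial derivatives: with `g` frozen at
  -- `1` it is `X`, and with `c` frozen at `A` it is the fundamental vector.
  have h1 : SmoothFamily (fun q : ℝ × ℝ => (c q.1).gauge (g q.2)) :=
    (hc.1.comp contDiff_fst).gauge (hg.1.comp contDiff_snd)
  refine hasDerivAt_diag (f := fun q : ℝ × ℝ => (c q.1).gauge (g q.2) v)
    ((h1.slice v).differentiable (by simp) _) ?_ ?_
  · simp only [hg.2.1, Connection.gauge_one]
    exact hc.2.2 v
  · simp only [hc.2.1]
    exact hg.hasDerivAt_gauge A v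

end Velocity

/-! ### Independence of the derivative of `γ` from the chosen curve. -/

section CurveIndependence

/-- The affine line `s ↦ A + s Z` of connections. -/
def Connection.line (A : Connection B) (Z : Tensorial B) (s : ℝ) : Connection B where
  toFun v := A v + s • Z v
  isOneForm :=
    { smooth := A.isOneForm.smooth.add ((contDiff_const_smul s).contMDiff.comp Z.isOneForm.smooth)
      map_add := fun p u v => by
        rw [A.isOneForm.map_add, Z.isOneForm.map_add, smul_add]; abel
      map_smul := fun p a v => by
        rw [A.isOneForm.map_smul, Z.isOneForm.map_smul, smul_add, smul_comm s a] }
  equivariant h v := by rw [A.equivariant, Z.equivariant, map_add, map_smul]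
  map_vert X p := by rw [A.map_vert, Z.map_vert, smul_zero, add_zero]

theorem smoothFamily_line (A : Connection B) (Z : Tensorial B) : SmoothFamily (A.line Z) :=
  ((A.isOneForm.smooth.comp contMDiff_snd).add
    ((contMDiff_fst (I := 𝓘(ℝ, ℝ))).smul (Z.isOneForm.smooth.comp contMDiff_snd))).congr
    fun _ => rfl

theorem isCurveAt_line (A : Connection B) (Z : Tensorial B) : IsCurveAt (A.line Z) A Z := by
  refine ⟨smoothFamily_line A Z, Connection.ext' fun v => ?_, fun v => ?_⟩
  · show A v + (0 : ℝ) • Z v = A v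
    simp
  · show HasDerivAt (fun s : ℝ => A v + s • Z v) (Z v) 0
    simpa using ((hasDerivAt_id (0 : ℝ)).smul_const (Z v)).const_add (A v)

variable [FiniteDimensional ℝ EP] [CompleteSpace EH]

theorem SmoothFamily.contMDiff_dslope {c : ℝ → Connection B} (hc : SmoothFamily c) :
    ContMDiff (𝓘(ℝ, ℝ).prod 𝓘(ℝ, EP).tangent) 𝓘(ℝ, EH) ∞
      (fun q : ℝ × TangentBundle 𝓘(ℝ, EP) P => dslope (fun τ => c τ q.2) 0 q.1) :=
  contMDiff_dslope_zero (f := fun τ v => c τ v) hc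

/-- The difference quotients of a smooth curve of connections. -/
def SmoothFamily.quotient {c : ℝ → Connection B} (hc : SmoothFamily c) (t : ℝ) : Tensorial B where
  toFun v := dslope (fun τ => c τ v) 0 t
  isOneForm :=
    { smooth := hc.contMDiff_dslope.comp (contMDiff_const.prodMk contMDiff_id)
      map_add := fun p u v => by
        rcases eq_or_ne t 0 with rfl | ht
        · simp only [dslope_same]
          exact hc.velocity.isOneForm.map_add p u v
        · simp only [dslope_of_ne _ ht, slope_def_module, (c _).isOneForm.map_add]
          rw [← smul_add]; congr 1; abel
      map_smul := fun p a v => by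
        rcases eq_or_ne t 0 with rfl | ht
        · simp only [dslope_same]
          exact hc.velocity.isOneForm.map_smul p a v
        · simp only [dslope_of_ne _ ht, slope_def_module, (c _).isOneForm.map_smul]
          rw [← smul_sub, smul_comm] }
  equivariant h v := by
    rcases eq_or_ne t 0 with rfl | ht
    · simp only [dslope_same]
      exact hc.velocity.equivariant h v
    · simp only [dslope_of_ne _ ht, slope_def_module, (c _).equivariant, map_smul, map_sub]
  map_vert X p := by
    rcases eq_or_ne t 0 with rfl | ht
    · simp only [dslope_same]
      exact hc.velocity.map_vert X p
    · simp only [dslope_of_ne _ ht, slope_def_module, (c _).map_vert, sub_self, smul_zero]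

theorem SmoothFamily.line_quotient_self {c : ℝ → Connection B} (hc : SmoothFamily c) (t : ℝ) :
    (c 0).line (hc.quotient t) t = c t := by
  refine Connection.ext' fun v => ?_
  show c 0 v + t • dslope (fun τ => c τ v) 0 t = c t v
  have h := sub_smul_dslope (fun τ => c τ v) 0 t
  rw [sub_zero] at h
  rw [h]; abel

theorem SmoothFamily.smoothFamily_line_quotient {c : ℝ → Connection B} (hc : SmoothFamily c)
    (A : Connection B) : SmoothFamily (fun q : ℝ × ℝ => A.line (hc.quotient q.2) q.1) := by
  have h1 : ContMDiff (𝓘(ℝ, ℝ × ℝ).prod 𝓘(ℝ, EP).tangent) 𝓘(ℝ, EH) ∞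
      (fun q : (ℝ × ℝ) × TangentBundle 𝓘(ℝ, EP) P => dslope (fun τ => c τ q.2) 0 q.1.2) :=
    ContMDiff.comp (f := fun q : (ℝ × ℝ) × TangentBundle 𝓘(ℝ, EP) P => (q.1.2, q.2))
      hc.contMDiff_dslope ((contDiff_snd.contMDiff.comp contMDiff_fst).prodMk contMDiff_snd)
  exact ((A.isOneForm.smooth.comp contMDiff_snd).add
    ((contDiff_fst.contMDiff.comp contMDiff_fst).smul h1)).congr fun _ => rfl

variable [LieGroup 𝓘(ℝ, EH) ∞ H]

/-- The diagonal direction is `(1,0) + (0,1)`, and the derivative along `(0,1)` vanishes because `f`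
is constant there. -/
theorem mder_diag {f : ℝ × ℝ → H} (hf : ContMDiff 𝓘(ℝ, ℝ × ℝ) 𝓘(ℝ, EH) ∞ f) {h : H}
    (h0 : ∀ t, f (0, t) = h) :
    mder 𝓘(ℝ, ℝ) 𝓘(ℝ, EH) (fun τ => f (τ, τ)) 0 = mder 𝓘(ℝ, ℝ) 𝓘(ℝ, EH) (fun s => f (s, 0)) 0 := by
  have hd : MDifferentiableAt 𝓘(ℝ, ℝ × ℝ) 𝓘(ℝ, EH) f (0, 0) := hf.mdifferentiable (by simp) _
  have hc : ∀ k : ℝ → ℝ × ℝ, k 0 = (0, 0) → ∀ k' : ℝ →L[ℝ] ℝ × ℝ, HasFDerivAt k k' 0 →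
      mder 𝓘(ℝ, ℝ) 𝓘(ℝ, EH) (fun τ => f (k τ)) 0 = (mder 𝓘(ℝ, ℝ × ℝ) 𝓘(ℝ, EH) f (0, 0)).comp k' := by
    intro k hk k' hk'
    rw [mder_comp hd (mdifferentiableAt_iff_differentiableAt.2 hk'.differentiableAt) hk,
      mder_eq_fderiv, hk'.fderiv]
  have h1 := hc (fun τ => (τ, τ)) rfl _ ((hasFDerivAt_id (0 : ℝ)).prodMk (hasFDerivAt_id (0 : ℝ)))
  have h2 := hc (fun τ => (τ, 0)) rfl _ ((hasFDerivAt_id (0 : ℝ)).prodMk (hasFDerivAt_const (0 : ℝ) 0))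
  have h3 := hc (fun τ => (0, τ)) rfl _ ((hasFDerivAt_const (0 : ℝ) 0).prodMk (hasFDerivAt_id (0 : ℝ)))
  simp only [h0] at h3
  rw [mder_const] at h3
  rw [h1, h2]
  ext
  have h4 := congrArg (fun L : ℝ →L[ℝ] EH => L 1) h3
  have h5 : ((1 : ℝ), (1 : ℝ)) = (1, 0) + (0, 1) := by simp
  simp at h4 ⊢
  rw [h5, map_add, ← h4, add_zero]

/-- The velocity of `γ(c τ) γ(A)⁻¹` depends only on the velocity of `c`. -/
theorem FieldGauge.mder_curve_eq (γ : FieldGauge B) {A : Connection B} {X : Tensorial B}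
    {c : ℝ → Connection B} (hc : IsCurveAt c A X) (k : Gauge B) (p : P) :
    mder 𝓘(ℝ, ℝ) 𝓘(ℝ, EH) (fun τ => (γ (c τ) * k) p) 0 =
      mder 𝓘(ℝ, ℝ) 𝓘(ℝ, EH) (fun τ => (γ (A.line X τ) * k) p) 0 := by
  -- The family `A + s q(t)`, with `q` the difference quotient of `c`, is `c` on the diagonal
  -- (`h5`), the line with velocity `X` at `t = 0` (`h4`), and constant at `s = 0` (`h2`).
  have h1 := ((γ.smoothGaugeFamily (hc.1.smoothFamily_line_quotient A)).mul
    (smoothGaugeFamily_const k)).slice p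
  have h2 : ∀ Z : Tensorial B, A.line Z 0 = A := fun Z => (isCurveAt_line A Z).2.1
  have h3 := mder_diag h1 (h := (γ A * k) p) (fun t => by simp only [h2])
  have h4 : hc.1.quotient 0 = X := Tensorial.ext' fun v => by
    show dslope (fun τ => c τ v) 0 0 = X v
    rw [dslope_same, (hc.2.2 v).deriv]
  have h5 : ∀ τ, A.line (hc.1.quotient τ) τ = c τ := fun τ => by
    exact (congrArg (fun A' => A'.line (hc.1.quotient τ) τ) hc.2.1).symm.trans
      (hc.1.line_quotient_self τ)
  simpa only [h4, h5] using h3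

end CurveIndependence

/-! ### One-forms in charts and the variation of the exterior derivative. -/

section LocalForms

theorem contMDiffAt_tangentMap_chart_symm (p : P) {y : EP}
    (hy : y ∈ (extChartAt 𝓘(ℝ, EP) p).target) (w : EP) :
    ContMDiffAt 𝓘(ℝ, EP) 𝓘(ℝ, EP).tangent ∞ (fun x : EP =>
      tangentMap 𝓘(ℝ, EP) 𝓘(ℝ, EP) (extChartAt 𝓘(ℝ, EP) p).symm ⟨x, w⟩) y := by
  have : IsManifold 𝓘(ℝ, EP) 1 P := IsManifold.of_le (n := ∞) (by simp)
  have hop : IsOpen (extChartAt 𝓘(ℝ, EP) p).target := isOpen_extChartAt_target p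
  have h1 := (contMDiffOn_extChartAt_symm (I := 𝓘(ℝ, EP)) (n := ∞) p).contMDiffOn_tangentMapWithin
    (m := ∞) (by simp) hop.uniqueMDiffOn
  have h2 : ContMDiff 𝓘(ℝ, EP) 𝓘(ℝ, EP).tangent ∞
      (fun x : EP => (⟨x, w⟩ : TangentBundle 𝓘(ℝ, EP) EP)) :=
    contMDiff_vectorSpace_iff_contDiff.2 contDiff_const
  have h3 := ContMDiffOn.comp (f := fun x : EP => (⟨x, w⟩ : TangentBundle 𝓘(ℝ, EP) EP))
    (s := (extChartAt 𝓘(ℝ, EP) p).target) h1 h2.contMDiffOn fun x hx => hx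
  refine (h3.congr fun x hx => ?_).contMDiffAt (hop.mem_nhds hy)
  simp only [tangentMap, Function.comp_def, tangentMapWithin, mfderivWithin_of_isOpen hop hx]

theorem localForm_self (α : TangentBundle 𝓘(ℝ, EP) P → EH) (p : P) (w : EP) :
    localForm α p (extChartAt 𝓘(ℝ, EP) p p) w = α (tvec p w) := by
  show α (tvec ((extChartAt 𝓘(ℝ, EP) p).symm (extChartAt 𝓘(ℝ, EP) p p))
    (mder 𝓘(ℝ, EP) 𝓘(ℝ, EP) (extChartAt 𝓘(ℝ, EP) p).symm (extChartAt 𝓘(ℝ, EP) p p) w)) = _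
  rw [mder_extChartAt_symm_self, extChartAt_to_inv]
  rfl

theorem localForm_eq (α : TangentBundle 𝓘(ℝ, EP) P → EH) (p : P) (x w : EP) :
    localForm α p x w = α (tvec ((extChartAt 𝓘(ℝ, EP) p).symm x)
      (mder 𝓘(ℝ, EP) 𝓘(ℝ, EP) (extChartAt 𝓘(ℝ, EP) p).symm x w)) := rfl

theorem IsOneForm.differentiableAt_localForm {α : TangentBundle 𝓘(ℝ, EP) P → EH}
    (hα : IsOneForm α) (p : P) (w : EP) :
    DifferentiableAt ℝ (fun x => localForm α p x w) (extChartAt 𝓘(ℝ, EP) p p) := by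
  rw [← mdifferentiableAt_iff_differentiableAt]
  exact (hα.smooth.contMDiffAt.comp _ (contMDiffAt_tangentMap_chart_symm p
    (mem_extChartAt_target p) w)).mdifferentiableAt (by simp)

theorem SmoothFamily.contDiffAt_localForm {c : ℝ → Connection B} (hc : SmoothFamily c)
    (p : P) (w : EP) :
    ContDiffAt ℝ ∞ (Function.uncurry fun τ x => localForm (c τ) p x w)
      ((0 : ℝ), extChartAt 𝓘(ℝ, EP) p p) := by
  rw [← contMDiffAt_iff_contDiffAt]
  refine ContMDiffAt.comp (f := fun q : ℝ × EP => (q.1,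
    tangentMap 𝓘(ℝ, EP) 𝓘(ℝ, EP) (extChartAt 𝓘(ℝ, EP) p).symm ⟨q.2, w⟩)) _ (hc _)
    (contDiff_fst.contMDiff.contMDiffAt.prodMk ?_)
  exact ContMDiffAt.comp ((0 : ℝ), extChartAt 𝓘(ℝ, EP) p p)
    (contMDiffAt_tangentMap_chart_symm p (mem_extChartAt_target p) w)
    contDiff_snd.contMDiff.contMDiffAt

theorem extDerivOneForm_eq (α : TangentBundle 𝓘(ℝ, EP) P → EH) (p : P) (u v : EP) :
    extDerivOneForm α p u v =
      fderiv ℝ (fun x => localForm α p x v) (extChartAt 𝓘(ℝ, EP) p p) u -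
      fderiv ℝ (fun x => localForm α p x u) (extChartAt 𝓘(ℝ, EP) p p) v := rfl

theorem IsCurveAt.hasDerivAt_extDerivOneForm {c : ℝ → Connection B} {A : Connection B}
    {X : Tensorial B} (hc : IsCurveAt c A X) (p : P) (u v : EP) :
    HasDerivAt (fun τ => extDerivOneForm (c τ) p u v) (extDerivOneForm X p u v) 0 := by
  have h : ∀ u v : EP, HasDerivAt
      (fun τ => fderiv ℝ (fun x => localForm (c τ) p x v) (extChartAt 𝓘(ℝ, EP) p p) u)
      (fderiv ℝ (fun x => localForm X p x v) (extChartAt 𝓘(ℝ, EP) p p) u) 0 := fun u v => by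
    have h1 := hasDerivAt_fderiv_mixed (hc.1.contDiffAt_localForm p v) u
    have h2 : ∀ x, deriv (fun τ => localForm (c τ) p x v) 0 = localForm X p x v :=
      fun x => (hc.2.2 _).deriv
    simpa only [h2] using h1
  exact (h u v).sub (h v u)

end LocalForms

/-! ### Variation of curvature, the Ricci identity and gauge covariance. -/

section Curvature

variable [LieGroup 𝓘(ℝ, EH) ∞ H]

/-- The covariant exterior derivative `dZ + [A, Z]` of a tensorial form. -/
def covExtDeriv (A : Connection B) (Z : Tensorial B) (p : P) (u v : EP) : EH :=
  extDerivOneForm Z p u v + bracket H (A (tvec p u)) (Z (tvec p v)) +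
    bracket H (Z (tvec p u)) (A (tvec p v))

theorem curvature_tvec (A : Connection B) (p : P) (u v : EP) :
    curvature A ⟨p, u, v⟩ =
      extDerivOneForm A p u v + bracket H (A (tvec p u)) (A (tvec p v)) := rfl

variable [FiniteDimensional ℝ EH]

theorem IsCurveAt.hasDerivAt_curvature {c : ℝ → Connection B} {A : Connection B}
    {X : Tensorial B} (hc : IsCurveAt c A X) (p : P) (u v : EP) :
    HasDerivAt (fun τ => curvature (c τ) ⟨p, u, v⟩) (covExtDeriv A X p u v) 0 := by
  simp only [curvature_tvec, covExtDeriv, ← bracketL_apply]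
  have h1 : HasDerivAt (fun τ => bracketL EH H (c τ (tvec p u))) (bracketL EH H (X (tvec p u))) 0 :=
    (bracketL EH H).hasFDerivAt.comp_hasDerivAt (0 : ℝ) (hc.2.2 (tvec p u))
  have h2 := (hc.hasDerivAt_extDerivOneForm p u v).add (h1.clm_apply (hc.2.2 (tvec p v)))
  refine h2.congr_deriv ?_
  rw [hc.2.1]
  abel

theorem covExtDeriv_add (A : Connection B) (Z W : Tensorial B) (p : P) (u v : EP) :
    covExtDeriv A (Z + W) p u v = covExtDeriv A Z p u v + covExtDeriv A W p u v := by
  have h1 : ∀ u v : EP, fderiv ℝ (fun x => localForm (Z + W) p x v) (extChartAt 𝓘(ℝ, EP) p p) u =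
      fderiv ℝ (fun x => localForm Z p x v) (extChartAt 𝓘(ℝ, EP) p p) u +
      fderiv ℝ (fun x => localForm W p x v) (extChartAt 𝓘(ℝ, EP) p p) u := fun u v => by
    have := fderiv_add (Z.isOneForm.differentiableAt_localForm p v)
      (W.isOneForm.differentiableAt_localForm p v)
    exact congrArg (fun L : EP →L[ℝ] EH => L u) this
  have h2 : ∀ u : EP, (Z + W) (tvec p u) = Z (tvec p u) + W (tvec p u) := fun _ => rfl
  simp only [covExtDeriv, extDerivOneForm_eq, h1, h2, ← bracketL_apply, map_add,
    add_apply]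
  abel

/-- `D^A D^A χ = [F(A), χ]`. -/
theorem covExtDeriv_covDeriv (A : Connection B) (χ : LieGauge B) {V : Tensorial B}
    (hV : ∀ v, V v = covDeriv A χ v) (p : P) (u v : EP) :
    covExtDeriv A V p u v = bracket H (curvature A ⟨p, u, v⟩) (χ p) := by
  have : CompleteSpace EH := FiniteDimensional.complete ℝ EH
  set φ := extChartAt 𝓘(ℝ, EP) p with hφ
  set x₀ := φ p with hx₀
  obtain ⟨f, hf⟩ : ∃ f : EP → EH, f = fun x => χ (φ.symm x) := ⟨_, rfl⟩
  have hmem : x₀ ∈ φ.target := mem_extChartAt_target p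
  have hfc : ContDiffAt ℝ ∞ f x₀ := by
    rw [← contMDiffAt_iff_contDiffAt, hf]
    exact ContMDiffAt.comp x₀ (χ.smooth _) (contMDiffAt_extChartAt_symm_self p hmem)
  have hfd : HasFDerivAt f (fderiv ℝ f x₀) x₀ := (hfc.differentiableAt (by simp)).hasFDerivAt
  have hff : HasFDerivAt (fderiv ℝ f) (fderiv ℝ (fderiv ℝ f) x₀) x₀ :=
    ((hfc.fderiv_right (m := ∞) (by simp)).differentiableAt (by simp)).hasFDerivAt
  have hsymm : ∀ a b, fderiv ℝ (fderiv ℝ f) x₀ a b = fderiv ℝ (fderiv ℝ f) x₀ b a :=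
    (hfc.isSymmSndFDerivAt (by
      rw [minSmoothness_of_isRCLikeNormedField]; exact WithTop.coe_le_coe.2 le_top)).eq
  have hf0 : f x₀ = χ p := by rw [hf]; simp only [hx₀, hφ, extChartAt_to_inv]
  have hdf : ∀ w, fderiv ℝ f x₀ w = mder 𝓘(ℝ, EP) 𝓘(ℝ, EH) χ p w := fun w => by
    rw [hf, ← mder_eq_fderiv, hx₀, hφ,
      mder_comp_chart_symm p (χ.smooth.mdifferentiable (by simp) p)]
  -- In coordinates `V = df + [A, f]`. This is claimed only near `x₀`, where the inverse chart is
  -- differentiable, and that suffices for the derivative at `x₀`.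
  have hloc : ∀ w, (fun x => localForm V p x w) =ᶠ[𝓝 x₀] fun x => fderiv ℝ f x w +
      bracketL EH H (localForm A p x w) (f x) := fun w => by
    filter_upwards [extChartAt_target_mem_nhds_self p hmem] with x hx
    rw [localForm_eq, hV, covDeriv_tvec, ← localForm_eq A.toFun, hf, ← mder_eq_fderiv,
      mder_comp (χ.smooth.mdifferentiable (by simp) (φ.symm x))
        ((contMDiffAt_extChartAt_symm_self p hx).mdifferentiableAt (by simp)) rfl]
    rfl
  have hder : ∀ a w, fderiv ℝ (fun x => localForm V p x w) x₀ a =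
      fderiv ℝ (fderiv ℝ f) x₀ a w + (bracket H (A (tvec p w)) (mder 𝓘(ℝ, EP) 𝓘(ℝ, EH) χ p a) +
        bracket H (fderiv ℝ (fun x => localForm A p x w) x₀ a) (χ p)) := fun a w => by
    have hA : HasFDerivAt (fun x => localForm A p x w)
        (fderiv ℝ (fun x => localForm A p x w) x₀) x₀ :=
      (A.isOneForm.differentiableAt_localForm p w).hasFDerivAt
    have h0 : localForm A p x₀ w = A (tvec p w) := localForm_self A p w
    have h1 := (bracketL EH H).hasFDerivAt.comp x₀ hA
    have h2 : HasFDerivAt (fun x => fderiv ℝ f x w + bracketL EH H (localForm A p x w) (f x)) _ x₀ :=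
      (hff.clm_apply (hasFDerivAt_const w x₀)).add (h1.clm_apply hfd)
    rw [(hloc w).fderiv_eq, h2.fderiv]
    simp [hdf, hf0, h0]
  -- After antisymmetrization the second derivatives of `f` cancel by `hsymm`, and the brackets of
  -- `A` with `dχ` cancel against those from `[A, V]`. What remains is `[dA, χ]` together with the
  -- double brackets, which the Jacobi identity `h1` collects into `[[A u, A v], χ]`.
  rw [covExtDeriv, extDerivOneForm_eq, hder, hder, hV, hV, covDeriv_tvec, covDeriv_tvec,
    curvature_tvec, extDerivOneForm_eq, hsymm u v, bracket_add_left, bracket_add_left,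
    bracket_add_right]
  have h1 := bracket_leibniz (H := H) (A (tvec p u)) (A (tvec p v)) (χ p)
  have h2 := bracket_skew (H := H) (A (tvec p v)) (bracket H (A (tvec p u)) (χ p))
  have h3 := bracket_skew (H := H) (A (tvec p v)) (mder 𝓘(ℝ, EP) 𝓘(ℝ, EH) χ p u)
  have h4 : ∀ a b c : EH, bracket H (a - b) c = bracket H a c - bracket H b c := fun a b c => by
    simp only [← bracketL_apply, map_sub, sub_apply]
  rw [h1, h2, h3, h4]
  abel

/-- Gauge covariance of the covariant exterior derivative. -/
theorem covExtDeriv_gauge (A : Connection B) (g : Gauge B) {Z Z' : Tensorial B}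
    (hZ : ∀ v, Z' v = Z (tangentMap 𝓘(ℝ, EP) 𝓘(ℝ, EP) g.map v)) (p : P) (u v : EP) :
    covExtDeriv (A.gauge g) Z' p u v = Ad (g p)⁻¹ (covExtDeriv A Z p u v) := by
  have : CompleteSpace EH := FiniteDimensional.complete ℝ EH
  set φ := extChartAt 𝓘(ℝ, EP) p with hφ
  set x₀ := φ p with hx₀
  have hmem : x₀ ∈ φ.target := mem_extChartAt_target p
  have hg : MDifferentiableAt 𝓘(ℝ, EP) 𝓘(ℝ, EH) (fun x => g (φ.symm x)) x₀ :=
    MDifferentiableAt.comp x₀ (g.mdifferentiableAt _)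
      ((contMDiffAt_extChartAt_symm_self p hmem).mdifferentiableAt (by simp))
  have hZ'p : ∀ w, Z' (tvec p w) = Ad (g p)⁻¹ (Z (tvec p w)) := fun w => by
    rw [hZ, Z.apply_tangentMap_map]
  -- Differentiating `Ad(g⁻¹)Z` produces an extra bracket with `g⁻¹dg`. It cancels against the
  -- inhomogeneous term of `A^g` in the bracket part of the covariant derivative.
  have hder : ∀ a w, fderiv ℝ (fun x => localForm Z' p x w) x₀ a =
      Ad (g p)⁻¹ (fderiv ℝ (fun x => localForm Z p x w) x₀ a) -
      bracket H (maurerCartan (g p) (mder 𝓘(ℝ, EP) 𝓘(ℝ, EH) g p a))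
        (Ad (g p)⁻¹ (Z (tvec p w))) := fun a w => by
    have h1 : (fun x => localForm Z' p x w) = fun x =>
        Ad (g (φ.symm x))⁻¹ (localForm Z p x w) := funext fun x => by
      rw [localForm_eq, hZ, Z.apply_tangentMap_map, ← localForm_eq Z.toFun]
    have h2 := hasFDerivAt_Ad_inv hg (Z.isOneForm.differentiableAt_localForm p w).hasFDerivAt
    rw [h1, h2.fderiv]
    have h3 : φ.symm x₀ = p := extChartAt_to_inv p
    have h4 : mder 𝓘(ℝ, EP) 𝓘(ℝ, EH) (fun x => g (φ.symm x)) x₀ = mder 𝓘(ℝ, EP) 𝓘(ℝ, EH) g p :=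
      mder_comp_chart_symm p (g.mdifferentiableAt p)
    rw [h3, h4, localForm_self]
    rfl
  rw [covExtDeriv, extDerivOneForm_eq, hder, hder, hZ'p, hZ'p, Connection.gauge_tvec,
    Connection.gauge_tvec, bracket_add_left, bracket_add_right, covExtDeriv, map_add, map_add,
    Ad_bracket, Ad_bracket, extDerivOneForm_eq, map_sub,
    bracket_skew (maurerCartan (g p) (mder 𝓘(ℝ, EP) 𝓘(ℝ, EH) g p v))
      (Ad (g p)⁻¹ (Z (tvec p u)))]
  abel

end Curvature

/-! ### Pullback of tensorial forms and the left logarithmic derivative. -/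

section GaugePullback

variable [LieGroup 𝓘(ℝ, EH) ∞ H]

/-- The pullback of a tensorial form by the vertical automorphism defined by a gauge group
element. -/
def Tensorial.gauge (Z : Tensorial B) (g : Gauge B) : Tensorial B where
  toFun := fun v => Z (tangentMap 𝓘(ℝ, EP) 𝓘(ℝ, EP) g.map v)
  isOneForm :=
    { smooth := Z.isOneForm.smooth.comp (g.contMDiff_map.contMDiff_tangentMap (by simp))
      map_add := fun p u v => by
        have := Z.isOneForm.map_add (g.map p)
          (mfderiv 𝓘(ℝ, EP) 𝓘(ℝ, EP) g.map p u) (mfderiv 𝓘(ℝ, EP) 𝓘(ℝ, EP) g.map p v)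
        rw [← ContinuousLinearMap.map_add] at this
        exact this
      map_smul := fun p a v => by
        have := Z.isOneForm.map_smul (g.map p) a (mfderiv 𝓘(ℝ, EP) 𝓘(ℝ, EP) g.map p v)
        rw [← ContinuousLinearMap.map_smul] at this
        exact this }
  equivariant := fun h v => by rw [g.tangentMap_rightPush, Z.equivariant]
  map_vert := fun X p => by rw [g.tangentMap_vert, Z.map_vert]

/-- The velocity of `γ(A)⁻¹ γ(c τ)` depends only on the velocity of `c`. -/
theorem FieldGauge.mder_inv_mul_curve_eq [FiniteDimensional ℝ EP] [CompleteSpace EH]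
    (γ : FieldGauge B) {A : Connection B} {X : Tensorial B}
    {c : ℝ → Connection B} (hc : IsCurveAt c A X) (p : P) :
    mder 𝓘(ℝ, ℝ) 𝓘(ℝ, EH) (fun τ => ((γ A)⁻¹ * γ (c τ)) p) 0 1 =
      mder 𝓘(ℝ, ℝ) 𝓘(ℝ, EH) (fun τ => ((γ A)⁻¹ * γ (A.line X τ)) p) 0 1 := by
  -- The left curve `γ(A)⁻¹ γ(c)` is the conjugate by `γ(A)⁻¹` of the right curve `γ(c) γ(A)⁻¹`, so
  -- curve independence transfers through `Ad`.
  have hR : ∀ {c' : ℝ → Connection B}, IsCurveAt c' A X →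
      mder 𝓘(ℝ, ℝ) 𝓘(ℝ, EH) (fun τ => ((γ A)⁻¹ * γ (c' τ)) p) 0 1 =
      Ad (γ A p)⁻¹ (mder 𝓘(ℝ, ℝ) 𝓘(ℝ, EH) (fun τ => (γ (c' τ) * (γ A)⁻¹) p) 0 1) := fun {c'} hc' => by
    have hs : SmoothGaugeFamily (fun τ => γ (c' τ) * (γ A)⁻¹) :=
      (γ.smoothGaugeFamily hc'.1).mul (smoothGaugeFamily_const _)
    have h1 : (γ (c' 0) * (γ A)⁻¹) p = 1 :=
      Gauge.apply_of_eq_one (by rw [hc'.2.1, mul_inv_cancel]) p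
    rw [Ad_eq_mder, ← mder_comp_apply (mdifferentiableAt_conj (γ A p)⁻¹ 1)
      (hs.mdifferentiableAt p 0) h1]
    congr 2
    funext τ
    show (γ A p)⁻¹ * γ (c' τ) p = (γ A p)⁻¹ * (γ (c' τ) p * (γ A p)⁻¹) * (γ A p)⁻¹⁻¹
    group
  rw [hR hc, hR (isCurveAt_line A X), γ.mder_curve_eq hc]

end GaugePullback

end GaugeBundle
end

/-! ### The pushforward and the transformed variations. -/

open GaugeBundle in
theorem mainTheorem5
    {EM EP EH : Type*} [NormedAddCommGroup EM] [NormedSpace ℝ EM] [FiniteDimensional ℝ EM]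
    [NormedAddCommGroup EP] [NormedSpace ℝ EP] [FiniteDimensional ℝ EP]
    [NormedAddCommGroup EH] [NormedSpace ℝ EH] [FiniteDimensional ℝ EH]
    {M P H : Type*}
    [TopologicalSpace M] [T2Space M] [ChartedSpace EM M] [IsManifold 𝓘(ℝ, EM) ∞ M]
    [TopologicalSpace P] [T2Space P] [ChartedSpace EP P] [IsManifold 𝓘(ℝ, EP) ∞ P]
    [TopologicalSpace H] [T2Space H] [ChartedSpace EH H] [Group H] [LieGroup 𝓘(ℝ, EH) ∞ H]
    (B : PrincipalBundle EM EP EH M P H)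
    (Ψ : Connection B → Connection B) (hΨ : IsVerticalAutomorphism Ψ)
    (γ : FieldGauge B) (hγ : ∀ A, Ψ A = A.gauge (γ A))
    (A : Connection B) (X : Tensorial B) :
    ∃ (ξ ζ : LieGauge B) (V V' Y W : Tensorial B),
      -- `ξ = dγ γ⁻¹|_A (X)`, `ζ = γ⁻¹ dγ|_A (X)`
      IsRightLogDeriv γ A X ξ ∧ IsLeftLogDeriv γ A X ζ ∧
      -- `V = {ξ}^v_A`, `V' = {ζ}^v_{Ψ(A)}`
      IsFundamental A ξ V ∧ IsFundamental (Ψ A) ζ V' ∧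
      -- `W = Ψ_⋆ X = R_{γ(A)⋆} X + {ζ}^v_{Ψ(A)} = R_{γ(A)⋆} (X + {ξ}^v_A)`
      IsPushforward Ψ A X W ∧
      IsPushforward (fun A' => A'.gauge (γ A)) A X Y ∧ W = Y + V' ∧
      IsPushforward (fun A' => A'.gauge (γ A)) A (X + V) W ∧
      -- `(Ψ^⋆ dA)_A (X) = dA_{Ψ(A)} (Ψ_⋆ X) = γ(A)⁻¹ (dA_A (X) + D^A ξ) γ(A)`
      (∃ a : TangentBundle 𝓘(ℝ, EP) P → EH,
        IsVariation (fun (A' : Connection B) v => A' v) A X a ∧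
        IsVariation (fun (A' : Connection B) v => A' v) (Ψ A) W
          (fun v => Ad (γ A v.1)⁻¹ (a v + covDeriv A ξ v))) ∧
      -- `(Ψ^⋆ dF)_A (X) = dF_{Ψ(A)} (Ψ_⋆ X) = γ(A)⁻¹ (dF_A (X) + [F(A), ξ]) γ(A)`
      (∃ f : TangentPair EP P → EH,
        IsVariation curvature A X f ∧
        IsVariation curvature (Ψ A) W
          (fun q => Ad (γ A q.1)⁻¹ (f q + bracket H (curvature A q) (ξ q.1)))) := by
  have : CompleteSpace EH := FiniteDimensional.complete ℝ EH
  have hline := isCurveAt_line A X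
  -- the velocities along the affine line through `A`
  have hR0 : γ (A.line X 0) * (γ A)⁻¹ = 1 := by rw [hline.2.1, mul_inv_cancel]
  have hRs : ∀ {c : ℝ → Connection B}, SmoothFamily c →
      SmoothGaugeFamily (fun τ => γ (c τ) * (γ A)⁻¹) := fun hc =>
    (γ.smoothGaugeFamily hc).mul (smoothGaugeFamily_const _)
  have hLs : ∀ {c : ℝ → Connection B}, SmoothFamily c →
      SmoothGaugeFamily (fun τ => (γ A)⁻¹ * γ (c τ)) := fun hc =>
    (smoothGaugeFamily_const _).mul (γ.smoothGaugeFamily hc)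
  have hL0 : (γ A)⁻¹ * γ (A.line X 0) = 1 := by rw [hline.2.1, inv_mul_cancel]
  -- The affine line through `A` supplies one curve with velocity `X` on which to define `ξ` and
  -- `ζ`; curve independence then gives the same velocities on every other curve.
  let ξ : LieGauge B := (hRs hline.1).velocity hR0
  let ζ : LieGauge B := (hLs hline.1).velocity hL0
  have hξ : IsRightLogDeriv γ A X ξ := fun c hc =>
    IsGaugeCurve.of_mder (hRs hc.1) (by rw [hc.2.1, mul_inv_cancel]) fun p => by
      rw [γ.mder_curve_eq hc]; rfl
  have hζ : IsLeftLogDeriv γ A X ζ := fun c hc =>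
    IsGaugeCurve.of_mder (hLs hc.1) (by rw [hc.2.1, inv_mul_cancel]) fun p =>
      γ.mder_inv_mul_curve_eq hc p
  have hgξ := hξ _ hline
  have hgζ := hζ _ hline
  have hVs := (smoothFamily_const (F := ℝ) A).gauge hgξ.1
  have hV's := (smoothFamily_const (F := ℝ) (Ψ A)).gauge hgζ.1
  let V : Tensorial B := hVs.velocity
  let V' : Tensorial B := hV's.velocity
  have hV : ∀ v, V v = covDeriv A ξ v := fun v => (hgξ.hasDerivAt_gauge A v).deriv
  have hV' : ∀ v, V' v = covDeriv (Ψ A) ζ v := fun v => (hgζ.hasDerivAt_gauge (Ψ A) v).deriv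
  let Y : Tensorial B := X.gauge (γ A)
  -- `W` is defined by the second form of the pushforward; the first form is then the identity
  -- `hVW`.
  let W : Tensorial B := (X + V).gauge (γ A)
  have hfix : ∀ Z : Tensorial B,
      IsPushforward (fun A' => A'.gauge (γ A)) A Z (Z.gauge (γ A)) := fun Z c hc =>
    ⟨hc.1.gauge (smoothGaugeFamily_const _), congrArg (fun A' => A'.gauge (γ A)) hc.2.1,
      fun v => hc.2.2 _⟩
  have hfund : ∀ (A' : Connection B) (χ : LieGauge B) (Z : Tensorial B) (g : ℝ → Gauge B),
      IsGaugeCurve g χ → (∀ v, Z v = covDeriv A' χ v) → IsFundamental A' χ Z :=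
    fun A' χ Z g hg hZ => ⟨⟨g, hg⟩, fun k hk =>
      ⟨(smoothFamily_const A').gauge hk.1, (congrArg A'.gauge hk.2.1).trans A'.gauge_one,
        fun v => by rw [hZ]; exact hk.hasDerivAt_gauge A' v⟩⟩
  have hVW : W = Y + V' := Tensorial.ext' fun v => by
    show X (tangentMap _ _ (γ A).map v) + V (tangentMap _ _ (γ A).map v) =
      X (tangentMap _ _ (γ A).map v) + V' v
    congr 1
    rw [hV, hV']
    -- Both fundamental vectors are velocities of one curve, `A^γ(A + τX)`, factored as `(A^(γ(A +
    -- τX) γ(A)⁻¹))^γ(A)` or as `Ψ(A)^(γ(A)⁻¹ γ(A + τX))`.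
    refine (hgξ.hasDerivAt_gauge A (tangentMap _ _ (γ A).map v)).unique ?_
    refine (hgζ.hasDerivAt_gauge (Ψ A) v).congr_of_eventuallyEq (Filter.Eventually.of_forall fun τ => ?_)
    show ((A.gauge (γ (A.line X τ) * (γ A)⁻¹)).gauge (γ A)) v =
      ((Ψ A).gauge ((γ A)⁻¹ * γ (A.line X τ))) v
    rw [hγ, ← Connection.gauge_mul, ← Connection.gauge_mul, inv_mul_cancel_right,
      mul_inv_cancel_left]
  have hW : IsPushforward Ψ A X W := fun c hc => by
    refine ⟨hΨ.smoothFamily hc.1, congrArg Ψ hc.2.1, fun v => ?_⟩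
    -- Writing `Ψ(c τ)` as `(c(τ)^(γ(c τ) γ(A)⁻¹))^γ(A)` reduces its velocity on `v` to that of the
    -- inner curve on the vector pushed by `γ(A)`.
    have h1 := hc.hasDerivAt_gauge (hξ c hc) (tangentMap _ _ (γ A).map v)
    rw [← hV] at h1
    refine h1.congr_of_eventuallyEq (Filter.Eventually.of_forall fun τ => ?_)
    show Ψ (c τ) v = (((c τ).gauge (γ (c τ) * (γ A)⁻¹)).gauge (γ A)) v
    rw [hγ, ← Connection.gauge_mul, inv_mul_cancel_right]
  have hF : ∀ (p : P) (u v : EP), covExtDeriv (Ψ A) W p u v =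
      Ad (γ A p)⁻¹ (covExtDeriv A X p u v + bracket H (curvature A ⟨p, u, v⟩) (ξ p)) :=
    fun p u v => by
      rw [hγ, covExtDeriv_gauge A (γ A) (Z := X + V) (Z' := W) (fun v => rfl), covExtDeriv_add,
        covExtDeriv_covDeriv A ξ hV]
  refine ⟨ξ, ζ, V, V', Y, W, hξ, hζ, hfund A ξ V _ hgξ hV, hfund (Ψ A) ζ V' _ hgζ hV', hW,
    hfix X, hVW, hfix (X + V), ⟨X, fun c hc v => hc.2.2 v, fun c hc v => ?_⟩,
    ⟨fun q => covExtDeriv A X q.1 q.2.1 q.2.2, fun c hc q => hc.hasDerivAt_curvature q.1 q.2.1 q.2.2,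
      fun c hc q => ?_⟩⟩
  · have h1 := hc.2.2 v
    rw [show W v = Ad (γ A v.1)⁻¹ (X v + covDeriv A ξ v) from by
      rw [← hV]; exact (X + V).apply_tangentMap_map (γ A) v.1 v.2] at h1
    exact h1
  · exact (hc.hasDerivAt_curvature q.1 q.2.1 q.2.2).congr_deriv (hF q.1 q.2.1 q.2.2)
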